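/- Call a Borel probability measure $\mu$ on $\mathbb{R}^n$ log-concave if $\mu(tA+(1-t)B)\ge \mu(A)^t\mu(B)^{1-t}$ for all Borel sets $A,B\subset\mathbb{R}^n$ and all $t\in(0,1)$, and isotropic if $\int x\,d\mu(x)=0$ and $\int\langle x,\theta\rangle^2\,d\mu(x)=1$ for every unit vector $\theta$; a random vector is called log-concave or isotropic if its law is. Let $e_1,\dots,e_n$ be the standard basis of $\mathbb{R}^n$. For every $n$ there is a constant $C(n)>0$, depending only on $n$, such that the following holds. Let $X$ and $Y$ be independent log-concave random vectors in $\mathbb{R}^n$ (possibly concentrated on proper affine subspaces) with diagonal covariance matrices, such that $X+Y$ is isotropic. Let $1\le i\le n$ be such that $\operatorname{Var}\langle X,e_i\rangle>0$ and $\operatorname{Var}\langle Y,e_i\rangle>0$. Then $X+Y$ has a density $f:\mathbb{R}^n\to[0,\infty)$ with respect to Lebesgue measure which is Lipschitz in direction $e_i$ in the sense that $$|f(x+te_i)-f(x)|\le \frac{C(n)}{\sqrt{\operatorname{Var}\langle X,e_i\rangle\,\operatorname{Var}\langle Y,e_i\rangle}}\,|t|\qquad\text{for all }x\in\mathbb{R}^n,\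 t\in\mathbb{R}.$$ In particular, if $X$ and $Y$ are centred, the constant is $C(n)/\sqrt{\mathbb{E}\langle X,e_i\rangle^2\,\mathbb{E}\langle Y,e_i\rangle^2}$. -/

import Mathlib

open MeasureTheory ProbabilityTheory
open scoped ENNReal Pointwise

/-- A Borel measure on `ℝⁿ` is log-concave if
`μ (t A + (1 - t) B) ≥ μ(A) ^ t * μ(B) ^ (1 - t)` for all Borel sets `A`, `B` and all `t ∈ (0, 1)`
(Minkowski sum on the left; if that set is not Borel, `μ` is the outer measure).
The measure is allowed to be concentrated on a lower-dimensional affine subspace. -/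
def IsLogConcaveMeasure {n : ℕ} (μ : Measure (EuclideanSpace ℝ (Fin n))) : Prop :=
  ∀ A B : Set (EuclideanSpace ℝ (Fin n)), MeasurableSet A → MeasurableSet B →
    ∀ t : ℝ, 0 < t → t < 1 →
      (μ A) ^ t * (μ B) ^ (1 - t) ≤ μ (t • A + (1 - t) • B)

/-- A measure on `ℝⁿ` is isotropic if its barycentre is `0` and `∫ ⟨x, θ⟩² dμ(x) = 1` for every
unit vector `θ`. (A Bochner integral equal to `1` is that of an integrable function, so finiteness
of the second moments is part of the condition.) -/
def IsIsotropicMeasure {n : ℕ} (μ : Measure (EuclideanSpace ℝ (Fin n))) : Prop :=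
  (∫ x, x ∂μ = 0) ∧
    ∀ θ : EuclideanSpace ℝ (Fin n), ‖θ‖ = 1 → ∫ x, (inner ℝ x θ) ^ 2 ∂μ = 1

/-- The covariance matrix of a random vector in `ℝⁿ`. -/
noncomputable def covarianceMatrix {Ω : Type*} [MeasurableSpace Ω] {n : ℕ}
    (X : Ω → EuclideanSpace ℝ (Fin n)) (P : Measure Ω) : Matrix (Fin n) (Fin n) ℝ :=
  Matrix.of fun i j => covariance (fun ω => X ω i) (fun ω => X ω j) P

/-- `f` is Lipschitz in direction `θ` (a unit vector) with the constant `L`. -/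
def LipschitzInDirection {n : ℕ} (f : EuclideanSpace ℝ (Fin n) → ℝ)
    (θ : EuclideanSpace ℝ (Fin n)) (L : ℝ) : Prop :=
  ∀ (x : EuclideanSpace ℝ (Fin n)) (t : ℝ), |f (x + t • θ) - f x| ≤ L * |t|

/-- `f` is a probability density (with respect to Lebesgue measure) of the random vector `Z`. -/
def IsDensityOf {Ω : Type*} [MeasurableSpace Ω] {n : ℕ} (f : EuclideanSpace ℝ (Fin n) → ℝ)
    (Z : Ω → EuclideanSpace ℝ (Fin n)) (P : Measure Ω) : Prop :=
  Measurable f ∧ (∀ x, 0 ≤ f x) ∧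
    P.map Z = (volume : Measure (EuclideanSpace ℝ (Fin n))).withDensity
      (fun x => ENNReal.ofReal (f x))

/-!
The proof rests on the pointwise bound `exists_expEnvelope_bound`: a log-concave probability density
`g` on `ℝⁿ` with mean `m` and covariance matrix `diag a`, `a > 0`, satisfies
`g x ≤ A ∏ⱼ aⱼ^(-1/2) exp (-c |xⱼ - mⱼ| / √aⱼ)` with constants depending only on `n`. Let `g` and `h`
be such densities for `X` and `Y`, with variances `a` and `b`. On each line parallel to `eᵢ` the
function `h` is unimodal, so its translation by `t` changes it in `L¹` by at most `2 |t|` times its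
maximum on the line (`lintegral_abs_translate_sub_le`). Hence `g * h` changes by at most `2 |t|` times
the integral, over the other coordinates, of the product of the two maxima along `eᵢ`. By the bound
this is a constant times `|t| (aᵢ bᵢ)^(-1/2)`, because for every `j ≠ i` one of `aⱼ`, `bⱼ` is at least
`1/2`, and the exponential with the other scale is integrable (`lintegral_mul_abs_translate_sub_le`).

The pointwise bound is proved from scaling towards a point `x₀` where `g` is nearly maximal. Outside
`K = {g ≥ η² g x₀}`, log-concavity gives `g x ≤ η g ((x + x₀) / 2)` (`le_contraction`), so moments over
the complement of `K` are small multiples of full moments. Consequently linear functionals are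
anti-concentrated (`anticoncentration`) and `K` reaches a definite number of standard deviations beyond
the mean in every direction; by Hahn–Banach it contains a box of comparable size around the mean
(`openBox_subset`). The volume of the box bounds `g x₀`, and log-concavity on segments from the box,
with Chebyshev's inequality, gives the decay (`le_exp_of_openBox`).

Degenerate laws need no separate treatment. Adding independent uniform noise on a small cube to `X`
and `Y` produces the densities `x ↦ μ(x + [-δ, δ]ⁿ) / (2δ)ⁿ`, whose log-concavity is immediate from that
of `μ`, and adds `δ² / 3` to each variance. The resulting estimates are uniform in `δ` and pass to the
limit on compact sets (`exists_conv_compact_estimates`). They make the law of `X + Y` absolutely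
continuous, and the upper limit of its averages over shrinking cubes is a version of the density that
satisfies the Lipschitz estimate at every point (`exists_lipschitz_density`).
-/

/-! ### Unimodal functions on the line -/

/-- If two points of the set `{s | λ ≤ p (s + t), p s < λ}` (or its mirror image) were further apart
than `|t|`, a point outside the superlevel set of `p` would lie between two points inside it. -/
theorem ediam_superlevel_diff_le {p : ℝ → ℝ}
    (hq : ∀ s u s', s ≤ u → u ≤ s' → min (p s) (p s') ≤ p u) (t l : ℝ) :
    Metric.ediam {s | p s < l ∧ l ≤ p (s + t)} ≤ ENNReal.ofReal |t| ∧
      Metric.ediam {s | p (s + t) < l ∧ l ≤ p s} ≤ ENNReal.ofReal |t| := by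
  have key : ∀ a b c, l ≤ p a → l ≤ p b → p c < l → a ≤ c → c ≤ b → False := by
    intro a b c ha hb hc h1 h2
    have := hq a c b h1 h2
    have := le_min ha hb
    linarith
  have hsym : ∀ A : Set ℝ, (∀ x ∈ A, ∀ y ∈ A, ¬ (|t| < y - x)) →
      Metric.ediam A ≤ ENNReal.ofReal |t| := by
    intro A hA
    refine Metric.ediam_le fun x hx y hy => ?_
    rw [edist_dist, Real.dist_eq]
    refine ENNReal.ofReal_le_ofReal (abs_le.2 ⟨?_, ?_⟩)
    · have := not_lt.1 (hA x hx y hy); linarith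
    · have := not_lt.1 (hA y hy x hx); linarith
  constructor
  · refine hsym _ fun x hx y hy hxy => ?_
    rcases le_total 0 t with ht | ht
    · rw [abs_of_nonneg ht] at hxy
      exact key (x + t) (y + t) y hx.2 hy.2 hy.1 (by linarith) (by linarith)
    · rw [abs_of_nonpos ht] at hxy
      exact key (x + t) (y + t) x hx.2 hy.2 hx.1 (by linarith) (by linarith)
  · refine hsym _ fun x hx y hy hxy => ?_
    rcases le_total 0 t with ht | ht
    · rw [abs_of_nonneg ht] at hxy
      exact key x y (x + t) hx.2 hy.2 hx.1 (by linarith) (by linarith)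
    · rw [abs_of_nonpos ht] at hxy
      exact key x y (y + t) hx.2 hy.2 hy.1 (by linarith) (by linarith)

/-- A unimodal function bounded by `H` moves by at most `2 H |t|` in `L¹` under translation by `t`:
by the layer-cake formula this is a statement on the superlevel sets, which are intervals. -/
theorem lintegral_abs_translate_sub_le {p : ℝ → ℝ} {H : ℝ} (hm : Measurable p)
    (h0 : ∀ s, 0 ≤ p s) (hH : ∀ s, p s ≤ H)
    (hq : ∀ s u s', s ≤ u → u ≤ s' → min (p s) (p s') ≤ p u) (t : ℝ) :
    ∫⁻ s, ENNReal.ofReal |p (s + t) - p s| ≤ ENNReal.ofReal (2 * H * |t|) := by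
  have hH0 : 0 ≤ H := (h0 0).trans (hH 0)
  let D : Set (ℝ × ℝ) := {q | min (p q.1) (p (q.1 + t)) < q.2 ∧ q.2 ≤ max (p q.1) (p (q.1 + t))}
  have hD : MeasurableSet D := by
    have h1 : Measurable fun q : ℝ × ℝ => min (p q.1) (p (q.1 + t)) := by fun_prop
    have h2 : Measurable fun q : ℝ × ℝ => max (p q.1) (p (q.1 + t)) := by fun_prop
    exact (measurableSet_lt h1 measurable_snd).inter (measurableSet_le measurable_snd h2)
  have e1 : (volume.prod volume) D = ∫⁻ s, ENNReal.ofReal |p (s + t) - p s| := by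
    rw [Measure.prod_apply hD]
    refine lintegral_congr fun s => ?_
    have : Prod.mk s ⁻¹' D = Set.uIoc (p s) (p (s + t)) := by
      ext l; simp [D, Set.uIoc]
    rw [this, Real.volume_uIoc]
  rw [← e1, Measure.prod_apply_symm hD]
  calc ∫⁻ l, volume ((fun s => (s, l)) ⁻¹' D)
      ≤ ∫⁻ l, (Set.Ioc 0 H).indicator (fun _ => 2 * ENNReal.ofReal |t|) l := by
        refine lintegral_mono fun l => ?_
        by_cases hl : l ∈ Set.Ioc 0 H
        · rw [Set.indicator_of_mem hl]
          obtain ⟨d1, d2⟩ := ediam_superlevel_diff_le hq t l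
          have hsub : (fun s => (s, l)) ⁻¹' D ⊆
              {s | p s < l ∧ l ≤ p (s + t)} ∪ {s | p (s + t) < l ∧ l ≤ p s} := by
            rintro s ⟨hs1, hs2⟩
            simp only [Set.mem_union, Set.mem_ofPred_eq]
            simp only [min_lt_iff, le_max_iff] at hs1 hs2
            rcases lt_or_ge (p s) l with h | h
            · exact Or.inl ⟨h, hs2.resolve_left (not_le.2 h)⟩
            · exact Or.inr ⟨hs1.resolve_left (not_lt.2 h), h⟩
          refine (measure_mono hsub).trans ((measure_union_le _ _).trans ?_)
          rw [two_mul]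
          exact add_le_add ((Real.volume_le_diam _).trans d1) ((Real.volume_le_diam _).trans d2)
        · have : (fun s => (s, l)) ⁻¹' D = ∅ := by
            refine Set.eq_empty_iff_forall_notMem.2 fun s hs => hl ⟨?_, ?_⟩
            · exact (le_min (h0 _) (h0 _)).trans_lt hs.1
            · exact hs.2.trans (max_le (hH _) (hH _))
          simp [this]
    _ = ENNReal.ofReal (2 * H * |t|) := by
        rw [lintegral_indicator measurableSet_Ioc, setLIntegral_const, Real.volume_Ioc, sub_zero,
          ENNReal.ofReal_mul (by positivity), ENNReal.ofReal_mul (by positivity)]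
        simp; ring

/-- Tonelli for a product of functions of single coordinates. -/
theorem lintegral_prod_coord {n : ℕ} (φ : Fin n → ℝ → ℝ≥0∞) (hφ : ∀ j, Measurable (φ j)) :
    ∫⁻ x : Fin n → ℝ, ∏ j, φ j (x j) = ∏ j, ∫⁻ s, φ j s := by
  induction n with
  | zero => simp [volume_pi]
  | succ n ih =>
    have h := (volume_preserving_piFinSuccAbove (fun _ : Fin (n + 1) => ℝ) 0).symm
    rw [← h.lintegral_comp (by fun_prop)]
    simp only [Fin.prod_univ_succ]
    rw [← ih _ fun j => hφ _]
    have hp : Measurable fun x : Fin n → ℝ => ∏ j, φ j.succ (x j) :=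
      Finset.measurable_fun_prod _ fun j _ => (hφ _).comp (measurable_pi_apply j)
    rw [← lintegral_prod_mul (hφ 0).aemeasurable hp.aemeasurable, ← Measure.volume_eq_prod]
    simp [MeasurableEquiv.piFinSuccAbove, Fin.insertNthEquiv]

theorem lintegral_exp_neg_abs {c m α : ℝ} (hc : 0 < c) (hα : 0 < α) :
    ∫⁻ s, ENNReal.ofReal (α⁻¹ * Real.exp (-c * |(s - m) / α|)) = ENNReal.ofReal (2 / c) := by
  have h1 : ∫ s, α⁻¹ * Real.exp (-c * |(s - m) / α|) = 2 / c := by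
    rw [integral_const_mul, integral_sub_right_eq_self (fun s => Real.exp (-c * |s / α|)) m,
      Measure.integral_comp_div (fun s => Real.exp (-c * |s|)) α,
      integral_comp_abs (f := fun s => Real.exp (-c * s)),
      integral_exp_mul_Ioi (by linarith) 0, smul_eq_mul, abs_of_pos hα]
    simp
    field_simp
  have h2 : Integrable fun s => α⁻¹ * Real.exp (-c * |(s - m) / α|) := by
    refine Integrable.of_integral_ne_zero ?_
    rw [h1]; positivity
  rw [← h1, ofReal_integral_eq_lintegral_ofReal h2
    (Filter.Eventually.of_forall fun s => by positivity)]

/-! ### Convolution of functions below exponential envelopes -/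

/-- The envelope `A ∏ⱼ αⱼ⁻¹ exp (-c |xⱼ - mⱼ| / αⱼ)`: a product of two-sided exponentials with
centre `m` and scales `α`. -/
noncomputable def expEnvelope {n : ℕ} (A c : ℝ) (m α : Fin n → ℝ) (x : Fin n → ℝ) : ℝ :=
  A * ∏ j, ((α j)⁻¹ * Real.exp (-c * |(x j - m j) / α j|))

/-- In each coordinate one of two scales is at least `1/2`, and the other factor is integrable. -/
theorem lintegral_two_exp_le {c m m' z α β : ℝ} (hc : 0 < c) (hα : 0 < α) (hβ : 0 < β)
    (hab : 1 / 2 ≤ α ∨ 1 / 2 ≤ β) :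
    ∫⁻ s, ENNReal.ofReal ((α⁻¹ * Real.exp (-c * |(s - m) / α|)) *
      (β⁻¹ * Real.exp (-c * |(z - s - m') / β|))) ≤ ENNReal.ofReal (4 / c) := by
  have hexp : ∀ u : ℝ, Real.exp (-c * |u|) ≤ 1 := fun u =>
    Real.exp_le_one_iff.2 (by nlinarith [abs_nonneg u])
  have h4 : ENNReal.ofReal 2 * ENNReal.ofReal (2 / c) = ENNReal.ofReal (4 / c) := by
    rw [← ENNReal.ofReal_mul (by norm_num)]; congr 1; ring
  have hinv : ∀ a : ℝ, 1 / 2 ≤ a → a⁻¹ ≤ 2 := fun a ha =>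
    (inv_anti₀ (by norm_num) ha).trans (by norm_num)
  rcases hab with h | h
  · rw [← h4, ← lintegral_exp_neg_abs (m := z - m') hc hβ,
      ← lintegral_const_mul _ (by fun_prop)]
    refine lintegral_mono fun s => ?_
    rw [← ENNReal.ofReal_mul (by norm_num)]
    refine ENNReal.ofReal_le_ofReal (mul_le_mul ?_ (le_of_eq ?_) (by positivity) (by norm_num))
    · calc α⁻¹ * Real.exp (-c * |(s - m) / α|) ≤ 2 * 1 :=
          mul_le_mul (hinv _ h) (hexp _) (by positivity) (by norm_num)
        _ = 2 := by norm_num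
    · rw [← abs_neg]; congr 4; ring
  · rw [← h4, ← lintegral_exp_neg_abs (m := m) hc hα,
      ← lintegral_const_mul _ (by fun_prop)]
    refine lintegral_mono fun s => ?_
    rw [← ENNReal.ofReal_mul (by norm_num), mul_comm]
    refine ENNReal.ofReal_le_ofReal (mul_le_mul ?_ le_rfl (by positivity) (by norm_num))
    calc β⁻¹ * Real.exp (-c * |(z - s - m') / β|) ≤ 2 * 1 :=
          mul_le_mul (hinv _ h) (hexp _) (by positivity) (by norm_num)
        _ = 2 := by norm_num

/-- The convolution of two functions below exponential envelopes is bounded by a constant that does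
not depend on the scales. -/
theorem lintegral_mul_le_of_expEnvelope {n : ℕ} {A c : ℝ} (hc : 0 < c)
    {m m' α β : Fin n → ℝ} (hα : ∀ j, 0 < α j) (hβ : ∀ j, 0 < β j)
    (hab : ∀ j, 1 / 2 ≤ α j ∨ 1 / 2 ≤ β j) {g h : (Fin n → ℝ) → ℝ}
    (hg0 : ∀ x, 0 ≤ g x) (hh0 : ∀ x, 0 ≤ h x)
    (hg : ∀ x, g x ≤ expEnvelope A c m α x) (hh : ∀ x, h x ≤ expEnvelope A c m' β x)
    (z : Fin n → ℝ) :
    ∫⁻ x, ENNReal.ofReal (g x) * ENNReal.ofReal (h (z - x)) ≤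
      ENNReal.ofReal (A ^ 2 * (4 / c) ^ n) := by
  calc ∫⁻ x, ENNReal.ofReal (g x) * ENNReal.ofReal (h (z - x))
      ≤ ∫⁻ x : Fin n → ℝ, ENNReal.ofReal (A ^ 2) *
          ∏ j, ENNReal.ofReal (((α j)⁻¹ * Real.exp (-c * |(x j - m j) / α j|)) *
            ((β j)⁻¹ * Real.exp (-c * |(z j - x j - m' j) / β j|))) := by
        refine lintegral_mono fun x => ?_
        have hp : ∀ j, 0 ≤ ((α j)⁻¹ * Real.exp (-c * |(x j - m j) / α j|)) *
            ((β j)⁻¹ * Real.exp (-c * |(z j - x j - m' j) / β j|)) := fun j => by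
          have := hα j; have := hβ j; positivity
        rw [← ENNReal.ofReal_mul (hg0 _), ← ENNReal.ofReal_prod_of_nonneg fun j _ => hp j,
          ← ENNReal.ofReal_mul (by positivity)]
        refine ENNReal.ofReal_le_ofReal ((mul_le_mul (hg x) (hh _) (hh0 _)
          ((hg0 x).trans (hg x))).trans (le_of_eq ?_))
        simp only [expEnvelope, Finset.prod_mul_distrib, Pi.sub_apply]
        ring
    _ ≤ ENNReal.ofReal (A ^ 2) * ∏ j : Fin n, ENNReal.ofReal (4 / c) := by
        rw [lintegral_const_mul _ (by fun_prop)]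
        refine mul_le_mul_right ?_ _
        rw [lintegral_prod_coord (fun j s => ENNReal.ofReal (((α j)⁻¹ *
          Real.exp (-c * |(s - m j) / α j|)) *
            ((β j)⁻¹ * Real.exp (-c * |(z j - s - m' j) / β j|)))) (fun j => by fun_prop)]
        exact Finset.prod_le_prod' fun j _ => lintegral_two_exp_le hc (hα j) (hβ j) (hab j)
    _ = _ := by
        rw [Finset.prod_const, Finset.card_univ, Fintype.card_fin,
          ENNReal.ofReal_mul (by positivity), ENNReal.ofReal_pow (n := n) (by positivity)]

/-- The directional Lipschitz estimate at the level of densities. On each line parallel to `eᵢ` one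
factor is bounded by its envelope and the other is unimodal; the remaining coordinates integrate to
a constant. -/
theorem lintegral_mul_abs_translate_sub_le {n : ℕ} {A c : ℝ} (hA : 0 ≤ A) (hc : 0 < c)
    {m m' α β : Fin n → ℝ} (hα : ∀ j, 0 < α j) (hβ : ∀ j, 0 < β j)
    (hab : ∀ j, 1 / 2 ≤ α j ∨ 1 / 2 ≤ β j) {g h : (Fin n → ℝ) → ℝ}
    (hgm : Measurable g) (hhm : Measurable h)
    (hh0 : ∀ x, 0 ≤ h x)
    (hg : ∀ x, g x ≤ expEnvelope A c m α x) (hh : ∀ x, h x ≤ expEnvelope A c m' β x)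
    (hq : QuasiconcaveOn ℝ Set.univ h) (i : Fin n) (z : Fin n → ℝ) (t : ℝ) :
    ∫⁻ x, ENNReal.ofReal (g x) *
        ENNReal.ofReal |h (z + t • Pi.single i 1 - x) - h (z - x)| ≤
      ENNReal.ofReal (2 * A ^ 2 * (4 / c) ^ (n - 1) / (α i * β i) * |t|) := by
  classical
  let a : Fin n → ℝ → ℝ := fun j s => (α j)⁻¹ * Real.exp (-c * |(s - m j) / α j|)
  let b : Fin n → ℝ → ℝ := fun j s => (β j)⁻¹ * Real.exp (-c * |(z j - s - m' j) / β j|)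
  have ha0 : ∀ j s, 0 ≤ a j s := fun j s => by have := hα j; positivity
  have hb0 : ∀ j s, 0 ≤ b j s := fun j s => by have := hβ j; positivity
  have hexp : ∀ u : ℝ, Real.exp (-c * |u|) ≤ 1 := fun u =>
    Real.exp_le_one_iff.2 (by nlinarith [abs_nonneg u])
  have hai : ∀ s, a i s ≤ (α i)⁻¹ := fun s => by
    have := hα i
    exact mul_le_of_le_one_right (by positivity) (hexp _)
  have hbi : ∀ s, b i s ≤ (β i)⁻¹ := fun s => by
    have := hβ i
    exact mul_le_of_le_one_right (by positivity) (hexp _)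
  have hga : ∀ x, g x ≤ A * ((α i)⁻¹ * ∏ j ∈ Finset.univ.erase i, a j (x j)) := fun x => by
    refine (hg x).trans (mul_le_mul_of_nonneg_left ?_ hA)
    rw [← Finset.mul_prod_erase _ _ (Finset.mem_univ i)]
    exact mul_le_mul_of_nonneg_right (hai _) (Finset.prod_nonneg fun j _ => ha0 _ _)
  have hhb : ∀ x, h (z - x) ≤ A * ((β i)⁻¹ * ∏ j ∈ Finset.univ.erase i, b j (x j)) := fun x => by
    refine (hh _).trans (mul_le_mul_of_nonneg_left ?_ hA)
    rw [← Finset.mul_prod_erase _ _ (Finset.mem_univ i)]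
    exact mul_le_mul_of_nonneg_right (hbi _) (Finset.prod_nonneg fun j _ => hb0 _ _)
  -- Integrating out only `xᵢ` gives the bound `K` times the remaining factors; the comparison function
  -- has the indicator of `[0, 1]` in the variable `xᵢ`, whose integral is `1`.
  let K : ℝ := 2 * A ^ 2 / (α i * β i) * |t|
  have hK : 0 ≤ K := by have := hα i; have := hβ i; positivity
  let φ : Fin n → ℝ → ℝ≥0∞ := fun j => if j = i then (Set.Icc (0 : ℝ) 1).indicator fun _ => 1 else
    fun s => ENNReal.ofReal (a j s * b j s)
  have hφ : ∀ j, Measurable (φ j) := fun j => by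
    by_cases hj : j = i
    · simp only [φ, hj, if_true]
      exact measurable_const.indicator measurableSet_Icc
    · simp only [φ, hj, if_false, a, b]
      fun_prop
  have hφm : Measurable fun x : Fin n → ℝ => ∏ j, φ j (x j) :=
    Finset.measurable_fun_prod _ fun j _ => (hφ _).comp (measurable_pi_apply j)
  calc ∫⁻ x, ENNReal.ofReal (g x) *
        ENNReal.ofReal |h (z + t • Pi.single i 1 - x) - h (z - x)|
      ≤ ∫⁻ x : Fin n → ℝ, ENNReal.ofReal K * ∏ j, φ j (x j) := by
        refine lintegral_le_of_lmarginal_le {i} ?_ (hφm.const_mul _) ?_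
        · fun_prop
        rw [lmarginal_singleton, lmarginal_singleton]
        intro x
        dsimp only
        set P : ℝ := ∏ j ∈ Finset.univ.erase i, a j (x j) with hP
        set Q : ℝ := ∏ j ∈ Finset.univ.erase i, b j (x j) with hQ
        have hP0 : 0 ≤ P := Finset.prod_nonneg fun j _ => ha0 _ _
        have hQ0 : 0 ≤ Q := Finset.prod_nonneg fun j _ => hb0 _ _
        have hne : ∀ j ∈ Finset.univ.erase i, ∀ s, Function.update x i s j = x j :=
          fun j hj s => Function.update_of_ne (Finset.ne_of_mem_erase hj) _ _
        have hR : ∫⁻ s, ENNReal.ofReal K * ∏ j, φ j (Function.update x i s j) =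
            ENNReal.ofReal (K * (P * Q)) := by
          have : ∀ s, ∏ j, φ j (Function.update x i s j) =
              (Set.Icc (0 : ℝ) 1).indicator (fun _ => ENNReal.ofReal (P * Q)) s := by
            intro s
            rw [← Finset.mul_prod_erase _ _ (Finset.mem_univ i), hP, hQ, ← Finset.prod_mul_distrib,
              ENNReal.ofReal_prod_of_nonneg fun j _ => mul_nonneg (ha0 _ _) (hb0 _ _)]
            have : ∏ j ∈ Finset.univ.erase i, φ j (Function.update x i s j) =
                ∏ j ∈ Finset.univ.erase i, ENNReal.ofReal (a j (x j) * b j (x j)) := by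
              refine Finset.prod_congr rfl fun j hj => ?_
              rw [hne j hj]
              simp only [φ, if_neg (Finset.ne_of_mem_erase hj)]
            rw [this, Function.update_self]
            simp only [φ, if_true, Set.indicator_apply]
            split_ifs <;> simp
          simp_rw [this]
          rw [lintegral_const_mul _ (measurable_const.indicator measurableSet_Icc),
            lintegral_indicator measurableSet_Icc, setLIntegral_const, Real.volume_Icc,
            ENNReal.ofReal_mul hK]
          simp
        rw [hR]
        let p : ℝ → ℝ := fun s => h (z - Function.update x i s)
        have hpt : ∀ s, h (z + t • Pi.single i 1 - Function.update x i s) = p (s + -t) := by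
          intro s
          simp only [p]
          congr 1
          ext j
          by_cases hj : j = i
          · subst hj; simp; ring
          · simp [hj]
        have hpm : Measurable p := hhm.comp (measurable_const.sub (measurable_update x))
        have hpH : ∀ s, p s ≤ A * ((β i)⁻¹ * Q) := by
          intro s
          refine (hhb _).trans (le_of_eq ?_)
          congr 2
          exact Finset.prod_congr rfl fun j hj => by rw [hne j hj]
        have hpq : ∀ s u s', s ≤ u → u ≤ s' → min (p s) (p s') ≤ p u := by
          intro s u s' h1 h2
          rcases h1.eq_or_lt with rfl | h1
          · exact min_le_left _ _
          have hd : 0 < s' - s := by linarith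
          have := (hq (min (p s) (p s'))) (x := z - Function.update x i s)
            ⟨trivial, min_le_left _ _⟩ (y := z - Function.update x i s')
            ⟨trivial, min_le_right _ _⟩ (a := (s' - u) / (s' - s)) (b := (u - s) / (s' - s))
            (div_nonneg (by linarith) hd.le) (div_nonneg (by linarith) hd.le)
            (by field_simp; ring)
          refine this.2.trans (le_of_eq ?_)
          simp only [p]
          congr 1
          ext j
          by_cases hj : j = i
          · subst hj; simp; field_simp; ring
          · simp [hj]; field_simp; ring
        have hpl := lintegral_abs_translate_sub_le hpm (fun s => hh0 _) hpH hpq (-t)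
        rw [abs_neg] at hpl
        calc ∫⁻ s, ENNReal.ofReal (g (Function.update x i s)) * ENNReal.ofReal
              |h (z + t • Pi.single i 1 - Function.update x i s) - h (z - Function.update x i s)|
            ≤ ∫⁻ s, ENNReal.ofReal (A * ((α i)⁻¹ * P)) * ENNReal.ofReal |p (s + -t) - p s| := by
              refine lintegral_mono fun s => ?_
              rw [hpt]
              refine mul_le_mul_left (ENNReal.ofReal_le_ofReal ((hga _).trans (le_of_eq ?_))) _
              congr 2
              exact Finset.prod_congr rfl fun j hj => by rw [hne j hj]
          _ ≤ ENNReal.ofReal (A * ((α i)⁻¹ * P)) *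
              ENNReal.ofReal (2 * (A * ((β i)⁻¹ * Q)) * |t|) := by
              rw [lintegral_const_mul _ (by fun_prop)]
              exact mul_le_mul_right hpl _
          _ = ENNReal.ofReal (K * (P * Q)) := by
              have := hα i
              rw [← ENNReal.ofReal_mul (by positivity)]
              congr 1
              simp only [K]
              rw [div_eq_mul_inv, mul_inv]
              ring
    _ = ENNReal.ofReal K * ∏ j, ∫⁻ s, φ j s := by
        rw [lintegral_const_mul _ hφm, lintegral_prod_coord φ hφ]
    _ ≤ ENNReal.ofReal K * ENNReal.ofReal ((4 / c) ^ (n - 1)) := by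
        refine mul_le_mul_right ?_ _
        rw [← Finset.mul_prod_erase _ _ (Finset.mem_univ i)]
        have h1 : ∫⁻ s, φ i s = 1 := by
          simp only [φ, if_true]
          rw [lintegral_indicator measurableSet_Icc]
          simp
        rw [h1, one_mul, ENNReal.ofReal_pow (by positivity)]
        refine (Finset.prod_le_prod' (g := fun _ => ENNReal.ofReal (4 / c)) fun j hj => ?_).trans
          (le_of_eq ?_)
        · simp only [φ, if_neg (Finset.ne_of_mem_erase hj)]
          exact lintegral_two_exp_le hc (hα j) (hβ j) (hab j)
        · simp
    _ = _ := by
        rw [← ENNReal.ofReal_mul hK]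
        congr 1
        simp only [K]
        ring

theorem conv_withDensity_apply_le {n : ℕ} {A c : ℝ} (hc : 0 < c)
    {m m' α β : Fin n → ℝ} (hα : ∀ j, 0 < α j) (hβ : ∀ j, 0 < β j)
    (hab : ∀ j, 1 / 2 ≤ α j ∨ 1 / 2 ≤ β j) {g h : (Fin n → ℝ) → ℝ}
    (hgm : Measurable g) (hhm : Measurable h)
    (hg0 : ∀ x, 0 ≤ g x) (hh0 : ∀ x, 0 ≤ h x)
    (hg : ∀ x, g x ≤ expEnvelope A c m α x) (hh : ∀ x, h x ≤ expEnvelope A c m' β x)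
    {S : Set (Fin n → ℝ)} (hS : MeasurableSet S) :
    (volume.withDensity (fun x => ENNReal.ofReal (g x)) ∗
      volume.withDensity (fun x => ENNReal.ofReal (h x))) S ≤
      ENNReal.ofReal (A ^ 2 * (4 / c) ^ n) * volume S := by
  rw [conv_withDensity_eq_lconvolution (by fun_prop) (by fun_prop), withDensity_apply _ hS,
    ← setLIntegral_const]
  refine lintegral_mono fun z => ?_
  simp only [lconvolution, neg_add_eq_sub]
  exact lintegral_mul_le_of_expEnvelope hc hα hβ hab hg0 hh0 hg hh z

theorem conv_withDensity_translate_le {n : ℕ} {A c : ℝ} (hA : 0 ≤ A) (hc : 0 < c)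
    {m m' α β : Fin n → ℝ} (hα : ∀ j, 0 < α j) (hβ : ∀ j, 0 < β j)
    (hab : ∀ j, 1 / 2 ≤ α j ∨ 1 / 2 ≤ β j) {g h : (Fin n → ℝ) → ℝ}
    (hgm : Measurable g) (hhm : Measurable h) (hh0 : ∀ x, 0 ≤ h x)
    (hg : ∀ x, g x ≤ expEnvelope A c m α x) (hh : ∀ x, h x ≤ expEnvelope A c m' β x)
    (hq : QuasiconcaveOn ℝ Set.univ h) (i : Fin n) (t : ℝ)
    {S : Set (Fin n → ℝ)} (hS : MeasurableSet S) :
    (volume.withDensity (fun x => ENNReal.ofReal (g x)) ∗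
      volume.withDensity (fun x => ENNReal.ofReal (h x)))
          ((fun x : Fin n → ℝ => x + t • (Pi.single i 1 : Fin n → ℝ)) ⁻¹' S) ≤
    (volume.withDensity (fun x => ENNReal.ofReal (g x)) ∗
      volume.withDensity (fun x => ENNReal.ofReal (h x))) S +
      ENNReal.ofReal (2 * A ^ 2 * (4 / c) ^ (n - 1) / (α i * β i) * |t|) * volume S := by
  rw [conv_withDensity_eq_lconvolution (by fun_prop) (by fun_prop), withDensity_apply _ hS,
    withDensity_apply _ (hS.preimage (by fun_prop)), ← setLIntegral_const,
    ← lintegral_add_right _ measurable_const]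
  set F := lconvolution (fun x => ENNReal.ofReal (g x)) (fun x => ENNReal.ofReal (h x)) volume
    with hF
  have hshift : ∫⁻ z in (fun x : Fin n → ℝ => x + t • (Pi.single i 1 : Fin n → ℝ)) ⁻¹' S, F z =
      ∫⁻ z in S, F (z - t • (Pi.single i 1 : Fin n → ℝ)) := by
    rw [← lintegral_indicator hS, ← lintegral_indicator (hS.preimage (by fun_prop))]
    refine Eq.trans (lintegral_congr fun z => ?_) (lintegral_add_right_eq_self
      (μ := (volume : Measure (Fin n → ℝ)))
      (S.indicator fun z => F (z - t • (Pi.single i 1 : Fin n → ℝ)))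
      (t • (Pi.single i 1 : Fin n → ℝ)))
    simp only [Set.indicator, add_sub_cancel_right]
    rfl
  rw [hshift]
  refine lintegral_mono fun z => ?_
  have key := lintegral_mul_abs_translate_sub_le hA hc hα hβ hab hgm hhm hh0 hg hh hq i z (-t)
  rw [abs_neg] at key
  refine le_trans ?_ (add_le_add_right key _)
  simp only [hF, lconvolution, neg_add_eq_sub]
  rw [← lintegral_add_left (by fun_prop)]
  refine lintegral_mono fun x => ?_
  rw [← mul_add, ← ENNReal.ofReal_add (hh0 _) (abs_nonneg _)]
  refine mul_le_mul_right (ENNReal.ofReal_le_ofReal ?_) _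
  rw [neg_smul, ← sub_eq_add_neg]
  linarith [le_abs_self (h (z - t • Pi.single i 1 - x) - h (z - x))]

/-! ### Log-concave densities and their superlevel sets -/

/-- The measure on `ℝⁿ` with Lebesgue density `g`. -/
noncomputable def densityMeasure {n : ℕ} (g : (Fin n → ℝ) → ℝ) : Measure (Fin n → ℝ) :=
  volume.withDensity fun x => ENNReal.ofReal (g x)

/-- A bounded probability density on `ℝⁿ` that is log-concave as a function. -/
structure IsLogConcaveDensity {n : ℕ} (g : (Fin n → ℝ) → ℝ) : Prop where
  measurable : Measurable g
  nonneg : ∀ x, 0 ≤ g x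
  bounded : ∃ B, ∀ x, g x ≤ B
  rpow_mul_rpow_le : ∀ x y (a b : ℝ), 0 < a → 0 < b → a + b = 1 →
    g x ^ a * g y ^ b ≤ g (a • x + b • y)
  isProbabilityMeasure : IsProbabilityMeasure (densityMeasure g)

/-- The measure has finite second moments, mean `m` and the diagonal covariance matrix with
entries `a`; the latter is expressed by the variances of all linear functionals. -/
structure HasDiagonalMoments {n : ℕ} (κ : Measure (Fin n → ℝ)) (m a : Fin n → ℝ) : Prop where
  memLp : ∀ j, MemLp (fun x => x j) 2 κ
  mean : ∀ j, ∫ x, x j ∂κ = m j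
  variance : ∀ θ : Fin n → ℝ, Var[fun x => ∑ j, θ j * x j; κ] = ∑ j, θ j ^ 2 * a j

theorem lintegral_comp_affine {n : ℕ} (F : (Fin n → ℝ) → ℝ≥0∞) (hF : Measurable F) {r : ℝ}
    (hr : 0 < r) (v : Fin n → ℝ) :
    ENNReal.ofReal (r ^ n) * ∫⁻ y, F (r • y + v) = ∫⁻ x, F x := by
  have h1 : ∫⁻ y, F (r • y + v) = ∫⁻ y, F (y + v) ∂(Measure.map (r • ·) volume) := by
    rw [lintegral_map (by fun_prop) (by fun_prop)]
  rw [h1, Measure.map_addHaar_smul _ hr.ne', lintegral_smul_measure,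
    lintegral_add_right_eq_self (μ := (volume : Measure (Fin n → ℝ))), Module.finrank_fin_fun,
    smul_eq_mul, ← mul_assoc, ← ENNReal.ofReal_mul (by positivity), abs_of_pos (by positivity),
    mul_inv_cancel₀ (by positivity), ENNReal.ofReal_one, one_mul]

theorem lintegral_densityMeasure {n : ℕ} {g : (Fin n → ℝ) → ℝ} (hg : Measurable g)
    {F : (Fin n → ℝ) → ℝ≥0∞} (hF : Measurable F) :
    ∫⁻ x, F x ∂densityMeasure g = ∫⁻ x, ENNReal.ofReal (g x) * F x := by
  rw [densityMeasure, lintegral_withDensity_eq_lintegral_mul _ (by fun_prop) hF]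
  rfl

namespace IsLogConcaveDensity

variable {n : ℕ} {g : (Fin n → ℝ) → ℝ}

theorem quasiconcaveOn (hg : IsLogConcaveDensity g) : QuasiconcaveOn ℝ Set.univ g := by
  intro r x hx y hy a b ha hb hab
  refine ⟨trivial, ?_⟩
  rcases ha.eq_or_lt with rfl | ha
  · simpa [show b = 1 by linarith] using hy.2
  rcases hb.eq_or_lt with rfl | hb
  · simpa [show a = 1 by linarith] using hx.2
  rcases le_or_gt r 0 with hr | hr
  · exact hr.trans (hg.nonneg _)
  refine le_trans ?_ (hg.rpow_mul_rpow_le x y a b ha hb hab)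
  calc r = r ^ a * r ^ b := by rw [← Real.rpow_add hr, hab, Real.rpow_one]
    _ ≤ g x ^ a * g y ^ b := mul_le_mul (Real.rpow_le_rpow hr.le hx.2 ha.le)
        (Real.rpow_le_rpow hr.le hy.2 hb.le) (by positivity)
        (Real.rpow_nonneg (hg.nonneg _) _)

theorem lintegral_eq_one (hg : IsLogConcaveDensity g) : ∫⁻ x, ENNReal.ofReal (g x) = 1 := by
  have := hg.isProbabilityMeasure.measure_univ
  rwa [densityMeasure, withDensity_apply _ MeasurableSet.univ, setLIntegral_univ] at this

theorem exists_half_max (hg : IsLogConcaveDensity g) : ∃ x₀, 0 < g x₀ ∧ ∀ x, g x ≤ 2 * g x₀ := by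
  obtain ⟨B, hB⟩ := hg.bounded
  have hbdd : BddAbove (Set.range g) := ⟨B, by rintro _ ⟨x, rfl⟩; exact hB x⟩
  have hpos : ∃ x, 0 < g x := by
    by_contra! h
    have := hg.lintegral_eq_one
    simp [ENNReal.ofReal_of_nonpos (h _)] at this
  obtain ⟨x, hx⟩ := hpos
  have hs : 0 < ⨆ x, g x := hx.trans_le (le_ciSup hbdd x)
  obtain ⟨x₀, hx₀⟩ := exists_lt_of_lt_ciSup (half_lt_self hs)
  exact ⟨x₀, (half_pos hs).trans hx₀, fun y => (le_ciSup hbdd y).trans (by linarith)⟩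

/-- Outside a superlevel set at level `η² g x₀`, log-concavity bounds the density by `η` times the
density contracted towards `x₀` by the factor `1/2`. -/
theorem le_contraction (hg : IsLogConcaveDensity g) {η : ℝ} (hη : 0 ≤ η) {x₀ x : Fin n → ℝ}
    (hx : g x < η ^ 2 * g x₀) : g x ≤ η * g ((1 / 2 : ℝ) • x + (1 / 2 : ℝ) • x₀) := by
  have h := hg.rpow_mul_rpow_le x x₀ (1 / 2) (1 / 2) (by norm_num) (by norm_num) (by norm_num)
  rw [← Real.sqrt_eq_rpow, ← Real.sqrt_eq_rpow] at h
  calc g x = √(g x) * √(g x) := (Real.mul_self_sqrt (hg.nonneg x)).symm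
    _ ≤ √(g x) * √(η ^ 2 * g x₀) := by gcongr
    _ = η * (√(g x) * √(g x₀)) := by
        rw [Real.sqrt_mul (by positivity), Real.sqrt_sq hη]; ring
    _ ≤ _ := by gcongr

theorem setLIntegral_compl_superlevel_le (hg : IsLogConcaveDensity g) {η : ℝ} (hη : 0 ≤ η)
    (x₀ : Fin n → ℝ) {F : (Fin n → ℝ) → ℝ≥0∞} (hF : Measurable F) :
    ∫⁻ x in {x | η ^ 2 * g x₀ ≤ g x}ᶜ, F x ∂densityMeasure g ≤
      ENNReal.ofReal (η * 2 ^ n) * ∫⁻ x, F ((2 : ℝ) • x + -x₀) ∂densityMeasure g := by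
  have hgm := hg.measurable
  have hK : MeasurableSet {x | η ^ 2 * g x₀ ≤ g x}ᶜ :=
    (measurableSet_le measurable_const hgm).compl
  rw [← lintegral_indicator hK, lintegral_densityMeasure hgm (hF.indicator hK),
    lintegral_densityMeasure hgm (by fun_prop)]
  have h2 := lintegral_comp_affine
    (fun x => ENNReal.ofReal (g ((1 / 2 : ℝ) • x + (1 / 2 : ℝ) • x₀)) * F x) (by fun_prop)
    (r := 2) (by norm_num) (-x₀)
  have h3 : ∀ y : Fin n → ℝ, (1 / 2 : ℝ) • ((2 : ℝ) • y + -x₀) + (1 / 2 : ℝ) • x₀ = y := by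
    intro y; ext j; simp
  simp only [h3] at h2
  rw [ENNReal.ofReal_mul hη, mul_assoc, h2, ← lintegral_const_mul _ (by fun_prop)]
  refine lintegral_mono fun x => ?_
  by_cases hx : x ∈ {x | η ^ 2 * g x₀ ≤ g x}ᶜ
  · rw [Set.indicator_of_mem hx, ← mul_assoc, ← ENNReal.ofReal_mul hη]
    gcongr
    exact hg.le_contraction hη (not_le.1 hx)
  · rw [Set.indicator_of_notMem hx]; simp

theorem real_compl_superlevel_le (hg : IsLogConcaveDensity g) {η : ℝ} (hη : 0 ≤ η)
    (x₀ : Fin n → ℝ) :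
    (densityMeasure g).real {x | η ^ 2 * g x₀ ≤ g x}ᶜ ≤ η * 2 ^ n := by
  have := hg.isProbabilityMeasure
  have h := hg.setLIntegral_compl_superlevel_le hη x₀ (F := fun _ => 1) measurable_const
  simp only [lintegral_one, Measure.restrict_apply_univ, measure_univ, mul_one] at h
  exact ENNReal.toReal_le_of_le_ofReal (by positivity) h

/-- Contracting a subset of a superlevel set towards one of the points of the superlevel set keeps
a fixed proportion of its mass. -/
theorem real_contraction_ge (hg : IsLogConcaveDensity g) {η α : ℝ} (hα : 0 < α)
    (hα1 : α ≤ 1) {x₀ k : Fin n → ℝ} (hx₀ : 0 < g x₀) (hmax : ∀ x, g x ≤ 2 * g x₀)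
    (hk : η ^ 2 * g x₀ ≤ g k) {S : Set (Fin n → ℝ)} (hS : MeasurableSet S)
    (hSK : ∀ x ∈ S, η ^ 2 * g x₀ ≤ g x) :
    η ^ 2 * α ^ n / 2 * (densityMeasure g).real S ≤
      (densityMeasure g).real {y | α⁻¹ • y + -(α⁻¹ • ((1 - α) • k)) ∈ S} := by
  have := hg.isProbabilityMeasure
  set v := -(α⁻¹ • ((1 - α) • k)) with hv
  have hT : MeasurableSet {y | α⁻¹ • y + v ∈ S} := hS.preimage (by fun_prop)
  have hvol := lintegral_comp_affine (S.indicator 1) (measurable_one.indicator hS)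
    (inv_pos.2 hα) v
  rw [lintegral_indicator_one hS] at hvol
  have hvol' : ∫⁻ y, S.indicator (1 : (Fin n → ℝ) → ℝ≥0∞) (α⁻¹ • y + v) =
      volume {y | α⁻¹ • y + v ∈ S} := by
    rw [← lintegral_indicator_one hT]
    rfl
  rw [hvol'] at hvol
  have h1 : densityMeasure g S ≤ ENNReal.ofReal (2 * g x₀) * volume S := by
    rw [densityMeasure, withDensity_apply _ hS, ← setLIntegral_const]
    exact lintegral_mono fun x => ENNReal.ofReal_le_ofReal (hmax x)
  have h2 : ENNReal.ofReal (η ^ 2 * g x₀) * volume {y | α⁻¹ • y + v ∈ S} ≤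
      densityMeasure g {y | α⁻¹ • y + v ∈ S} := by
    rw [densityMeasure, withDensity_apply _ hT, ← setLIntegral_const]
    refine setLIntegral_mono (by have := hg.measurable; fun_prop) fun y hy =>
      ENNReal.ofReal_le_ofReal ?_
    have hc := (hg.quasiconcaveOn (η ^ 2 * g x₀)) (x := k) ⟨trivial, hk⟩ (y := α⁻¹ • y + v)
      ⟨trivial, hSK _ hy⟩ (a := 1 - α) (b := α) (by linarith) hα.le (by ring)
    have : (1 - α) • k + α • (α⁻¹ • y + v) = y := by
      rw [hv, smul_add, smul_neg, smul_smul, smul_smul, mul_inv_cancel₀ hα.ne', one_smul, one_smul]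
      abel
    rw [this] at hc
    exact hc.2
  have h3 : ENNReal.ofReal (η ^ 2 * α ^ n / 2) * densityMeasure g S ≤
      densityMeasure g {y | α⁻¹ • y + v ∈ S} := by
    refine le_trans ?_ h2
    calc ENNReal.ofReal (η ^ 2 * α ^ n / 2) * densityMeasure g S
        ≤ ENNReal.ofReal (η ^ 2 * α ^ n / 2) * (ENNReal.ofReal (2 * g x₀) *
          (ENNReal.ofReal (α⁻¹ ^ n) * volume {y | α⁻¹ • y + v ∈ S})) := by
          rw [hvol]; gcongr
      _ = _ := by
          rw [← mul_assoc, ← mul_assoc, ← ENNReal.ofReal_mul (by positivity),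
            ← ENNReal.ofReal_mul (by positivity)]
          congr 2
          rw [inv_pow]
          field_simp
  have h4 := ENNReal.toReal_mono (measure_ne_top _ _) h3
  rwa [ENNReal.toReal_mul, ENNReal.toReal_ofReal (by positivity)] at h4

end IsLogConcaveDensity

/-! ### Anti-concentration of linear functionals -/

namespace IsLogConcaveDensity

variable {n : ℕ} {g : (Fin n → ℝ) → ℝ}

/-- On a superlevel set of mass close to `1`, a linear functional reaches half of its root mean square
`√J`, both measured relative to `x₀`: by contraction towards `x₀`, at most half of the second
moment `J` comes from outside the superlevel set. -/
theorem exists_superlevel_ge (hg : IsLogConcaveDensity g) {η : ℝ} (hη : 0 ≤ η)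
    (hη1 : η * 2 ^ (n + 3) ≤ 1) (x₀ θ : Fin n → ℝ) {J : ℝ}
    (hint : Integrable (fun x => (∑ j, θ j * (x j - x₀ j)) ^ 2) (densityMeasure g))
    (hJ : J = ∫ x, (∑ j, θ j * (x j - x₀ j)) ^ 2 ∂densityMeasure g) (hJ0 : 0 < J) :
    ∃ k, η ^ 2 * g x₀ ≤ g k ∧ J / 4 ≤ (∑ j, θ j * (k j - x₀ j)) ^ 2 := by
  by_contra! hcon
  have := hg.isProbabilityMeasure
  have hgm := hg.measurable
  set D : (Fin n → ℝ) → ℝ := fun x => ∑ j, θ j * (x j - x₀ j) with hD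
  have hDm : Measurable D := by fun_prop
  set K := {x | η ^ 2 * g x₀ ≤ g x} with hK
  have hKm : MeasurableSet K := measurableSet_le measurable_const hgm
  have hDs : ∀ y, D ((2 : ℝ) • y + -x₀) = 2 * D y := by
    intro y
    simp only [hD, Finset.mul_sum]
    refine Finset.sum_congr rfl fun j _ => ?_
    simp; ring
  have h1 := hg.setLIntegral_compl_superlevel_le hη x₀
    (F := fun x => ENNReal.ofReal (D x ^ 2)) (by fun_prop)
  have hJl : ∫⁻ x, ENNReal.ofReal (D x ^ 2) ∂densityMeasure g = ENNReal.ofReal J := by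
    rw [hJ, ofReal_integral_eq_lintegral_ofReal hint
      (Filter.Eventually.of_forall fun x => by positivity)]
  have h2 : ∫⁻ x, ENNReal.ofReal (D ((2 : ℝ) • x + -x₀) ^ 2) ∂densityMeasure g =
      ENNReal.ofReal (4 * J) := by
    rw [ENNReal.ofReal_mul (by norm_num), ← hJl, ← lintegral_const_mul _ (by fun_prop)]
    refine lintegral_congr fun x => ?_
    rw [hDs, ← ENNReal.ofReal_mul (by norm_num)]
    congr 1; ring
  rw [h2, ← ENNReal.ofReal_mul (by positivity)] at h1
  have h3 : ∫⁻ x in K, ENNReal.ofReal (D x ^ 2) ∂densityMeasure g ≤ ENNReal.ofReal (J / 4) := by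
    calc ∫⁻ x in K, ENNReal.ofReal (D x ^ 2) ∂densityMeasure g
        ≤ ∫⁻ x in K, ENNReal.ofReal (J / 4) ∂densityMeasure g :=
          setLIntegral_mono measurable_const fun x hx => ENNReal.ofReal_le_ofReal (hcon x hx).le
      _ ≤ _ := by
          rw [setLIntegral_const]
          exact mul_le_of_le_one_right (by positivity) prob_le_one
  have h4 := add_le_add h3 h1
  rw [lintegral_add_compl _ hKm, hJl, ← ENNReal.ofReal_add (by positivity) (by positivity),
    ENNReal.ofReal_le_ofReal_iff (by positivity)] at h4
  rw [pow_add] at hη1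
  nlinarith

end IsLogConcaveDensity

namespace HasDiagonalMoments

variable {n : ℕ} {κ : Measure (Fin n → ℝ)} {m a : Fin n → ℝ}

theorem memLp_functional (h : HasDiagonalMoments κ m a) (θ : Fin n → ℝ) :
    MemLp (fun x => ∑ j, θ j * x j) 2 κ :=
  memLp_finsetSum _ fun j _ => (h.memLp j).const_mul (θ j)

variable [IsProbabilityMeasure κ]

theorem memLp_functional_sub (h : HasDiagonalMoments κ m a) (θ w : Fin n → ℝ) :
    MemLp (fun x => ∑ j, θ j * (x j - w j)) 2 κ :=
  memLp_finsetSum _ fun j _ => ((h.memLp j).sub (memLp_const (w j))).const_mul (θ j)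

theorem integral_functional_sub (h : HasDiagonalMoments κ m a) (θ w : Fin n → ℝ) :
    ∫ x, ∑ j, θ j * (x j - w j) ∂κ = ∑ j, θ j * (m j - w j) := by
  have hi : ∀ j, Integrable (fun x : Fin n → ℝ => x j) κ := fun j =>
    (h.memLp j).integrable (by norm_num)
  have hi' : ∀ j ∈ Finset.univ, Integrable (fun x : Fin n → ℝ => θ j * (x j - w j)) κ :=
    fun j _ => ((hi j).sub (integrable_const _)).const_mul _
  rw [integral_finsetSum _ hi']
  refine Finset.sum_congr rfl fun j _ => ?_
  rw [integral_const_mul, integral_sub (hi j) (integrable_const _), h.mean]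
  simp

theorem integral_functional_sub_sq (h : HasDiagonalMoments κ m a) (θ w : Fin n → ℝ) :
    ∫ x, (∑ j, θ j * (x j - w j)) ^ 2 ∂κ =
      ∑ j, θ j ^ 2 * a j + (∑ j, θ j * (m j - w j)) ^ 2 := by
  have h1 := variance_eq_sub (h.memLp_functional_sub θ w)
  have h2 : Var[fun x => ∑ j, θ j * (x j - w j); κ] = ∑ j, θ j ^ 2 * a j := by
    rw [← h.variance θ]
    have : (fun x : Fin n → ℝ => ∑ j, θ j * (x j - w j)) =
        fun x => (∑ j, θ j * x j) - ∑ j, θ j * w j := by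
      ext x; simp only [mul_sub, Finset.sum_sub_distrib]
    rw [this]
    exact variance_sub_const (h.memLp_functional θ).aestronglyMeasurable _
  rw [h2, h.integral_functional_sub] at h1
  simp only [Pi.pow_apply] at h1
  linarith

/-- Chebyshev's inequality for a linear functional, around an arbitrary point. -/
theorem chebyshev (h : HasDiagonalMoments κ m a) (θ w : Fin n → ℝ) {R : ℝ} (hR : 0 < R) :
    κ.real {x | R ≤ |∑ j, θ j * (x j - w j)|} ≤
      (∑ j, θ j ^ 2 * a j + (∑ j, θ j * (m j - w j)) ^ 2) / R ^ 2 := by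
  rw [le_div_iff₀ (by positivity), mul_comm, ← h.integral_functional_sub_sq]
  refine le_trans (le_of_eq ?_) (mul_meas_ge_le_integral_of_nonneg
    (Filter.Eventually.of_forall fun x => sq_nonneg _) (h.memLp_functional_sub θ w).integrable_sq
    (R ^ 2))
  congr 2
  ext x
  simp only [Set.mem_ofPred_eq]
  rw [← sq_abs (∑ j, _), pow_le_pow_iff_left₀ hR.le (abs_nonneg _) two_ne_zero]

theorem chebyshev_coord (h : HasDiagonalMoments κ m a) (j : Fin n) (ha : 0 < a j) {R : ℝ}
    (hR : 0 < R) : κ.real {x | R * √(a j) ≤ |x j - m j|} ≤ 1 / R ^ 2 := by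
  have := h.chebyshev (Pi.single j 1) m (R := R * √(a j)) (by positivity)
  simp [Pi.single_apply, mul_pow, Real.sq_sqrt ha.le] at this
  refine this.trans (le_of_eq ?_)
  field_simp

end HasDiagonalMoments

namespace IsLogConcaveDensity

variable {n : ℕ} {g : (Fin n → ℝ) → ℝ} {m a : Fin n → ℝ}

/-- Anti-concentration: a linear functional deviates from its mean by a fixed multiple of its
standard deviation with a probability bounded below in terms of the dimension. The proof finds two
sets of definite mass, obtained by contracting the bulk of the measure towards two points, on which
the functional takes well separated values. -/
theorem anticoncentration (hg : IsLogConcaveDensity g)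
    (hm : HasDiagonalMoments (densityMeasure g) m a) {η : ℝ} (hη : 0 < η)
    (hη1 : η * 2 ^ (n + 3) ≤ 1) (θ : Fin n → ℝ) {q : ℝ} (hq : q = ∑ j, θ j ^ 2 * a j)
    (hq0 : 0 < q) :
    η ^ 2 * (1 / 16) ^ n / 4 ≤
      (densityMeasure g).real {x | √q / 16 ≤ |∑ j, θ j * (x j - m j)|} := by
  have := hg.isProbabilityMeasure
  have hgm := hg.measurable
  obtain ⟨x₀, hx₀, hmax⟩ := hg.exists_half_max
  set D : (Fin n → ℝ) → ℝ := fun x => ∑ j, θ j * (x j - x₀ j) with hD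
  set e : ℝ := ∑ j, θ j * (m j - x₀ j) with he
  have hDm : Measurable D := by fun_prop
  have hJ : q + e ^ 2 = ∫ x, D x ^ 2 ∂densityMeasure g := by
    rw [hm.integral_functional_sub_sq, hq]
  set J := q + e ^ 2 with hJdef
  have hJ0 : 0 < J := by positivity
  obtain ⟨k, hkK, hkJ⟩ := hg.exists_superlevel_ge hη.le hη1 x₀ θ
    (hm.memLp_functional_sub θ x₀).integrable_sq hJ hJ0
  set r := √J with hr
  have hr0 : 0 < r := Real.sqrt_pos.2 hJ0
  have hr2 : r ^ 2 = J := Real.sq_sqrt hJ0.le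
  have hkr : r / 2 ≤ |D k| := by
    refine (abs_le_of_sq_le_sq' (a := r / 2) (b := |D k|) ?_ (abs_nonneg _)).2
    rw [sq_abs]
    have : J / 4 ≤ D k ^ 2 := hkJ
    nlinarith
  set K := {x | η ^ 2 * g x₀ ≤ g x} with hK
  have hKm : MeasurableSet K := measurableSet_le measurable_const hgm
  -- the bulk: the part of the superlevel set within two root mean squares of `x₀`
  set S := K ∩ {x | |D x| < 2 * r} with hS
  have hSm : MeasurableSet S := hKm.inter (measurableSet_lt (by fun_prop) measurable_const)
  have hSmass : 1 / 2 ≤ (densityMeasure g).real S := by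
    have h1 : (densityMeasure g).real Kᶜ ≤ 1 / 8 :=
      (hg.real_compl_superlevel_le hη.le x₀).trans (by rw [pow_add] at hη1; linarith)
    have h2 := hm.chebyshev θ x₀ (R := 2 * r) (by positivity)
    rw [← hq, ← hJdef, ← hr2] at h2
    have h2' : (densityMeasure g).real {x | 2 * r ≤ |D x|} ≤ 1 / 4 :=
      h2.trans (le_of_eq (by field_simp; norm_num))
    have h3 : Sᶜ ⊆ Kᶜ ∪ {x | 2 * r ≤ |D x|} := by
      intro x hx
      by_contra h
      simp only [Set.mem_union, Set.mem_compl_iff, Set.mem_ofPred_eq, not_or, not_not, not_le] at h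
      exact hx h
    have h4 := (measureReal_mono (μ := densityMeasure g) h3).trans (measureReal_union_le _ _)
    rw [probReal_compl_eq_one_sub hSm] at h4
    linarith
  -- contraction of the bulk by the factor `1/16` towards a point of the superlevel set
  have hT : ∀ w, η ^ 2 * g x₀ ≤ g w → ∀ B : Set (Fin n → ℝ),
      (∀ y, |D y - 15 / 16 * D w| ≤ r / 8 → y ∈ B) →
      η ^ 2 * (1 / 16) ^ n / 4 ≤ (densityMeasure g).real B := by
    intro w hw B hB
    have h1 := hg.real_contraction_ge (α := 1 / 16) (by norm_num) (by norm_num) hx₀ hmax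
      hw hSm (fun x hx => hx.1)
    refine le_trans (le_trans ?_ h1) (measureReal_mono fun y hy => hB y ?_)
    · have : 0 ≤ η ^ 2 * (1 / 16) ^ n := by positivity
      nlinarith
    · have h2 := hy.2
      simp only [Set.mem_ofPred_eq] at h2
      have h3 : D ((1 / 16 : ℝ)⁻¹ • y + -((1 / 16 : ℝ)⁻¹ • ((1 - 1 / 16 : ℝ) • w))) =
          16 * (D y - 15 / 16 * D w) := by
        simp only [hD, Finset.mul_sum, ← Finset.sum_sub_distrib]
        refine Finset.sum_congr rfl fun j _ => ?_
        simp; ring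
      rw [h3, abs_mul, abs_of_pos (by norm_num : (0 : ℝ) < 16)] at h2
      linarith
  have hqr : √q ≤ r := Real.sqrt_le_sqrt (by rw [hJdef]; nlinarith [sq_nonneg e])
  have hζ : ∀ y, ∑ j, θ j * (y j - m j) = D y - e := by
    intro y
    simp only [hD, he, ← Finset.sum_sub_distrib]
    exact Finset.sum_congr rfl fun j _ => by ring
  have hDx₀ : D x₀ = 0 := by simp [hD]
  simp only [hζ]
  -- on the two contracted sets `|D| ≤ r / 8` and `|D| ≥ 11 r / 32`; one of them avoids `e`
  rcases le_total (15 * r / 64) |e| with h | h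
  · have hη2 : η ^ 2 ≤ 1 := by
      have : η ≤ 1 := by nlinarith [one_le_pow₀ (M₀ := ℝ) (a := 2) (n := n + 3) (by norm_num)]
      nlinarith
    refine hT x₀ (mul_le_of_le_one_left hx₀.le hη2) _ fun y hy => ?_
    rw [hDx₀, mul_zero, sub_zero] at hy
    simp only [Set.mem_ofPred_eq]
    have := abs_sub_abs_le_abs_sub e (D y)
    rw [abs_sub_comm] at this
    linarith
  · refine hT k hkK _ fun y hy => ?_
    simp only [Set.mem_ofPred_eq]
    have h1 := abs_sub_abs_le_abs_sub (15 / 16 * D k) (D y)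
    rw [abs_sub_comm, abs_mul, abs_of_pos (by norm_num : (0 : ℝ) < 15 / 16)] at h1
    have h2 := abs_sub_abs_le_abs_sub (D y) e
    linarith

/-- Every linear functional exceeds its mean by a fixed multiple of its standard deviation somewhere
on a superlevel set of sufficiently large mass. -/
theorem exists_superlevel_functional_ge (hg : IsLogConcaveDensity g)
    (hm : HasDiagonalMoments (densityMeasure g) m a) {c : ℝ} (hc : 0 < c)
    {θ : Fin n → ℝ} {q : ℝ} (hq : q = ∑ j, θ j ^ 2 * a j) (hq0 : 0 < q)
    (hac : c ≤ (densityMeasure g).real {x | √q / 16 ≤ |∑ j, θ j * (x j - m j)|})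
    {K : Set (Fin n → ℝ)} (hK : MeasurableSet K)
    (hKc : (densityMeasure g).real Kᶜ ≤ (c / 128) ^ 2) :
    ∃ k ∈ K, c / 64 * √q ≤ ∑ j, θ j * (k j - m j) := by
  by_contra! hcon
  have := hg.isProbabilityMeasure
  set ζ : (Fin n → ℝ) → ℝ := fun x => ∑ j, θ j * (x j - m j) with hζ
  set σ := √q with hσ
  have hσ0 : 0 < σ := Real.sqrt_pos.2 hq0
  have hσ2 : σ ^ 2 = q := Real.sq_sqrt hq0.le
  have hL := hm.memLp_functional_sub θ m
  have hζi : Integrable ζ (densityMeasure g) := hL.integrable (by norm_num)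
  have h0 : ∫ x, ζ x ∂densityMeasure g = 0 := by
    rw [hm.integral_functional_sub]; simp
  have h2 : ∫ x, ζ x ^ 2 ∂densityMeasure g = σ ^ 2 := by
    rw [hm.integral_functional_sub_sq, hσ2, hq]; simp
  have h1 : c * (σ / 16) ≤ ∫ x, |ζ x| ∂densityMeasure g := by
    refine le_trans ?_ (mul_meas_ge_le_integral_of_nonneg
      (Filter.Eventually.of_forall fun x => abs_nonneg _) hζi.abs (σ / 16))
    rw [mul_comm]
    exact mul_le_mul_of_nonneg_left hac (by positivity)
  set s := c / 128 with hs
  have hs0 : 0 < s := by positivity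
  -- if `ζ < c / 64 * σ` on `K`, then the positive part of `ζ` is too small on average: on the
  -- complement of `K` it is estimated by the weighted arithmetic-geometric mean inequality
  have hpt : ∀ x, |ζ x| + ζ x ≤
      2 * (c / 64 * σ) + (s / σ * ζ x ^ 2 + σ / s * Kᶜ.indicator 1 x) := by
    intro x
    by_cases hx : x ∈ K
    · have h3 := hcon x hx
      rw [Set.indicator_of_notMem (by simpa using hx), mul_zero, add_zero]
      have : 0 ≤ s / σ * ζ x ^ 2 := by positivity
      have h5 : |ζ x| + ζ x ≤ 2 * (c / 64 * σ) := by
        have h6 : ζ x < c / 64 * σ := h3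
        rcases abs_cases (ζ x) with h | h <;> [linarith; skip]
        have : 0 < c / 64 * σ := by positivity
        linarith
      linarith
    · rw [Set.indicator_of_mem hx, Pi.one_apply, mul_one]
      have h3 : 2 * |ζ x| ≤ s / σ * ζ x ^ 2 + σ / s := by
        have : s / σ * ζ x ^ 2 + σ / s - 2 * |ζ x| = (s * |ζ x| - σ) ^ 2 / (s * σ) := by
          rw [← sq_abs (ζ x)]; field_simp; ring
        have : 0 ≤ (s * |ζ x| - σ) ^ 2 / (s * σ) := by positivity
        linarith
      have : 0 < c / 64 * σ := by positivity
      linarith [le_abs_self (ζ x)]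
  have hind : Integrable (Kᶜ.indicator (1 : (Fin n → ℝ) → ℝ)) (densityMeasure g) :=
    (integrable_const (1 : ℝ)).indicator hK.compl
  have hsq : Integrable (fun x => ζ x ^ 2) (densityMeasure g) := hL.integrable_sq
  have hi1 : Integrable (fun x => s / σ * ζ x ^ 2 + σ / s * Kᶜ.indicator 1 x)
      (densityMeasure g) := (hsq.const_mul (s / σ)).add (hind.const_mul (σ / s))
  have hi2 := (integrable_const (μ := densityMeasure g) (2 * (c / 64 * σ))).add hi1
  have h3 := integral_mono (hζi.abs.add hζi) hi2 hpt
  have e1 : ∫ x, (|ζ x| + ζ x) ∂densityMeasure g = ∫ x, |ζ x| ∂densityMeasure g := by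
    rw [integral_add hζi.abs hζi, h0, add_zero]
  have e2 : ∫ x, (2 * (c / 64 * σ) + (s / σ * ζ x ^ 2 + σ / s * Kᶜ.indicator 1 x))
      ∂densityMeasure g = 2 * (c / 64 * σ) + (s / σ * σ ^ 2 +
        σ / s * (densityMeasure g).real Kᶜ) := by
    rw [integral_add (integrable_const _) hi1, integral_add (hsq.const_mul _)
      (hind.const_mul _), integral_const_mul (s / σ), integral_const_mul (σ / s), h2,
      integral_indicator_one hK.compl]
    simp
  have h3' : ∫ x, (|ζ x| + ζ x) ∂densityMeasure g ≤
    ∫ x, (2 * (c / 64 * σ) + (s / σ * ζ x ^ 2 + σ / s * Kᶜ.indicator 1 x))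
      ∂densityMeasure g := h3
  rw [e1, e2] at h3'
  have h4 : σ / s * (densityMeasure g).real Kᶜ ≤ σ * s := by
    calc σ / s * (densityMeasure g).real Kᶜ ≤ σ / s * s ^ 2 := by gcongr
      _ = σ * s := by field_simp
  have h5 : s / σ * σ ^ 2 = s * σ := by field_simp
  rw [h5] at h3'
  have : 0 < c * σ := by positivity
  rw [hs] at *
  nlinarith

end IsLogConcaveDensity

/-! ### Exponential decay of log-concave densities -/

theorem volume_openBox {n : ℕ} (w b : Fin n → ℝ) (hb : ∀ j, 0 ≤ b j) :
    volume {x : Fin n → ℝ | ∀ j, |x j - w j| < b j} = ENNReal.ofReal (∏ j, (2 * b j)) := by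
  have : {x : Fin n → ℝ | ∀ j, |x j - w j| < b j} =
      Set.univ.pi fun j => Set.Ioo (w j - b j) (w j + b j) := by
    ext x
    simp only [Set.mem_ofPred_eq, Set.mem_pi, Set.mem_univ, true_imp_iff, Set.mem_Ioo, abs_lt]
    exact forall_congr' fun j => ⟨fun h => ⟨by linarith [h.1], by linarith [h.2]⟩,
      fun h => ⟨by linarith [h.1], by linarith [h.2]⟩⟩
  rw [this, Real.volume_pi_Ioo, ENNReal.ofReal_prod_of_nonneg fun j _ => by
    have := hb j; positivity]
  exact Finset.prod_congr rfl fun j _ => by congr 1; ring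

theorem measurableSet_openBox {n : ℕ} (w b : Fin n → ℝ) :
    MeasurableSet {x : Fin n → ℝ | ∀ j, |x j - w j| < b j} := by
  have : {x : Fin n → ℝ | ∀ j, |x j - w j| < b j} = ⋂ j, {x | |x j - w j| < b j} := by
    ext; simp
  rw [this]
  exact MeasurableSet.iInter fun j => measurableSet_lt (by fun_prop) measurable_const

theorem real_densityMeasure_ge {n : ℕ} {g : (Fin n → ℝ) → ℝ} (hg : IsLogConcaveDensity g)
    {S : Set (Fin n → ℝ)} (hS : MeasurableSet S) {l v : ℝ} (hl : 0 ≤ l)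
    (hvol : volume S = ENNReal.ofReal v) (h : ∀ x ∈ S, l ≤ g x) :
    l * v ≤ (densityMeasure g).real S := by
  have := hg.isProbabilityMeasure
  have h1 : ENNReal.ofReal (l * v) ≤ densityMeasure g S := by
    rw [ENNReal.ofReal_mul hl, ← hvol, densityMeasure, withDensity_apply _ hS, ← setLIntegral_const]
    exact setLIntegral_mono (by have := hg.measurable; fun_prop)
      fun x hx => ENNReal.ofReal_le_ofReal (h x hx)
  exact (ENNReal.ofReal_le_iff_le_toReal (measure_ne_top _ _)).1 h1

theorem real_densityMeasure_le {n : ℕ} {g : (Fin n → ℝ) → ℝ}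
    {S : Set (Fin n → ℝ)} (hS : MeasurableSet S) {l v : ℝ} (hl : 0 ≤ l) (hv : 0 ≤ v)
    (hvol : volume S = ENNReal.ofReal v) (h : ∀ x, g x ≤ l) :
    (densityMeasure g).real S ≤ l * v := by
  have h1 : densityMeasure g S ≤ ENNReal.ofReal (l * v) := by
    rw [ENNReal.ofReal_mul hl, ← hvol, densityMeasure, withDensity_apply _ hS, ← setLIntegral_const]
    exact lintegral_mono fun x => ENNReal.ofReal_le_ofReal (h x)
  exact ENNReal.toReal_le_of_le_ofReal (by positivity) h1

namespace IsLogConcaveDensity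

variable {n : ℕ} {g : (Fin n → ℝ) → ℝ} {m a : Fin n → ℝ}

/-- A convex set of large mass that every linear functional leaves at a distance of a fixed multiple
of its standard deviation contains a box of comparable size around the mean, by Hahn–Banach. -/
theorem openBox_subset (hg : IsLogConcaveDensity g)
    (hm : HasDiagonalMoments (densityMeasure g) m a) (ha : ∀ j, 0 < a j) {c : ℝ} (hc : 0 < c)
    (hc1 : c ≤ 1)
    (hac : ∀ θ : Fin n → ℝ, 0 < ∑ j, θ j ^ 2 * a j →
      c ≤ (densityMeasure g).real {x | √(∑ j, θ j ^ 2 * a j) / 16 ≤ |∑ j, θ j * (x j - m j)|})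
    {K : Set (Fin n → ℝ)} (hK : MeasurableSet K) (hKconv : Convex ℝ K)
    (hKc : (densityMeasure g).real Kᶜ ≤ (c / 128) ^ 2) :
    {x | ∀ j, |x j - m j| < c / (64 * (n + 1)) * √(a j)} ⊆ K := by
  have := hg.isProbabilityMeasure
  intro x hx
  by_contra hxK
  have hint : (interior K).Nonempty := by
    rw [Set.nonempty_iff_ne_empty]
    intro hempty
    have h0 : volume K = 0 := by
      refine measure_mono_null ?_ (hKconv.addHaar_frontier volume)
      rw [frontier, hempty, Set.sdiff_empty]
      exact subset_closure
    have h1 : densityMeasure g K = 0 := withDensity_absolutelyContinuous _ _ h0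
    have h2 : (densityMeasure g).real Kᶜ = 1 := by
      rw [probReal_compl_eq_one_sub hK, measureReal_def, h1]; simp
    rw [h2] at hKc
    nlinarith
  obtain ⟨f, hf0, hf⟩ := geometric_hahn_banach_of_nonempty_interior_point hKconv
    (fun h => hxK (interior_subset h)) hint
  set θ : Fin n → ℝ := fun j => f (Pi.single j 1) with hθ
  have hfθ : ∀ y, f y = ∑ j, θ j * y j := by
    intro y
    conv_lhs => rw [pi_eq_sum_univ' y]
    simp [hθ, mul_comm]
  have hq0 : 0 < ∑ j, θ j ^ 2 * a j := by
    have hne : ∃ j, θ j ≠ 0 := by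
      by_contra! h
      exact hf0 (ContinuousLinearMap.ext fun y => by simp [hfθ, h])
    obtain ⟨j, hj⟩ := hne
    refine Finset.sum_pos' (fun i _ => mul_nonneg (sq_nonneg _) (ha i).le)
      ⟨j, Finset.mem_univ _, mul_pos (by positivity) (ha j)⟩
  obtain ⟨k, hkK, hk⟩ := hg.exists_superlevel_functional_ge hm hc rfl hq0 (hac θ hq0) hK hKc
  set σ := √(∑ j, θ j ^ 2 * a j) with hσ
  have hσ0 : 0 < σ := Real.sqrt_pos.2 hq0
  have h1 := hf k hkK
  have h2 : ∑ j, θ j * (x j - m j) ≤ ∑ j : Fin n, c / (64 * (n + 1)) * σ := by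
    refine Finset.sum_le_sum fun j _ => ?_
    have hj : |θ j| * √(a j) ≤ σ := by
      rw [← Real.sqrt_sq_eq_abs, ← Real.sqrt_mul (sq_nonneg _)]
      exact Real.sqrt_le_sqrt (Finset.single_le_sum (f := fun j => θ j ^ 2 * a j)
        (fun i _ => mul_nonneg (sq_nonneg _) (ha i).le) (Finset.mem_univ j))
    calc θ j * (x j - m j) ≤ |θ j| * |x j - m j| := by
          rw [← abs_mul]; exact le_abs_self _
      _ ≤ |θ j| * (c / (64 * (n + 1)) * √(a j)) := by gcongr; exact (hx j).le
      _ = c / (64 * (n + 1)) * (|θ j| * √(a j)) := by ring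
      _ ≤ _ := by gcongr
  rw [Finset.sum_const, Finset.card_univ, Fintype.card_fin, nsmul_eq_mul] at h2
  have h3 : ∑ j, θ j * (k j - m j) ≤ ∑ j, θ j * (x j - m j) := by
    simp only [mul_sub, Finset.sum_sub_distrib, ← hfθ]
    linarith
  have h4 : (n : ℝ) * (c / (64 * (n + 1)) * σ) < c / 64 * σ := by
    rw [show (n : ℝ) * (c / (64 * (n + 1)) * σ) = (c / 64 * σ) * (n / (n + 1)) by field_simp]
    exact mul_lt_of_lt_one_right (by positivity) ((div_lt_one (by positivity)).2 (by linarith))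
  linarith

/-- An upper bound `M` of the density cannot be too small: by Chebyshev's inequality, a box with side
lengths proportional to the standard deviations has mass at least `1/2`. -/
theorem half_le_max_mul (hg : IsLogConcaveDensity g)
    (hm : HasDiagonalMoments (densityMeasure g) m a) (ha : ∀ j, 0 < a j) {M : ℝ} (hM0 : 0 ≤ M)
    (hM : ∀ x, g x ≤ M) : 1 / 2 ≤ M * ((4 * (n + 1)) ^ n * ∏ j, √(a j)) := by
  have := hg.isProbabilityMeasure
  have hb : ∀ j, 0 ≤ 2 * ((n : ℝ) + 1) * √(a j) := fun j => by positivity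
  have h1 := real_densityMeasure_le (g := g) (measurableSet_openBox m _) hM0
    (Finset.prod_nonneg fun j _ => mul_nonneg zero_le_two (hb j)) (volume_openBox m _ hb) hM
  have h2 : ∏ j, (2 * (2 * ((n : ℝ) + 1) * √(a j))) = (4 * (n + 1)) ^ n * ∏ j, √(a j) := by
    simp only [← mul_assoc]
    rw [Finset.prod_mul_distrib, Finset.prod_const, Finset.card_univ, Fintype.card_fin]
    norm_num
  rw [h2] at h1
  refine le_trans ?_ h1
  set B := {x : Fin n → ℝ | ∀ j, |x j - m j| < 2 * ((n : ℝ) + 1) * √(a j)} with hB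
  have h3 : Bᶜ ⊆ ⋃ j, {x | 2 * ((n : ℝ) + 1) * √(a j) ≤ |x j - m j|} := by
    intro x hx
    simpa [hB] using hx
  have h4 := (measureReal_mono (μ := densityMeasure g) h3).trans (measureReal_iUnion_fintype_le _)
  have h5 : ∑ j, (densityMeasure g).real {x | 2 * ((n : ℝ) + 1) * √(a j) ≤ |x j - m j|} ≤
      ∑ j : Fin n, 1 / (2 * ((n : ℝ) + 1)) ^ 2 :=
    Finset.sum_le_sum fun j _ => hm.chebyshev_coord j (ha j) (by positivity)
  rw [Finset.sum_const, Finset.card_univ, Fintype.card_fin, nsmul_eq_mul] at h5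
  have h6 : (n : ℝ) * (1 / (2 * ((n : ℝ) + 1)) ^ 2) ≤ 1 / 2 := by
    rw [mul_one_div, div_le_div_iff₀ (by positivity) (by norm_num)]
    nlinarith [sq_nonneg (n : ℝ), (Nat.cast_nonneg n : (0 : ℝ) ≤ n)]
  have h7 : (densityMeasure g).real Bᶜ = _ :=
    probReal_compl_eq_one_sub (measurableSet_openBox m fun j => 2 * ((n : ℝ) + 1) * √(a j))
  linarith

/-- Exponential decay. If the density is at least `l` on a box around the mean, then log-concavity
bounds it below on a smaller box around each point between the mean and `x`. If the value at `x`
were too large, such a box at a distance of more than a fixed number of standard deviations would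
have more mass than Chebyshev's inequality allows. -/
theorem le_exp_of_openBox (hg : IsLogConcaveDensity g)
    (hm : HasDiagonalMoments (densityMeasure g) m a) (ha : ∀ j, 0 < a j) {c l κ₀ : ℝ} (hc : 0 < c)
    (hl : 0 < l) (hbox : ∀ x, (∀ j, |x j - m j| < c * √(a j)) → l ≤ g x)
    (hκ0 : 0 < κ₀) (hκ : κ₀ ≤ l * (c ^ n * ∏ j, √(a j))) {D : ℝ} (hD : D = c + 2 / √κ₀)
    (x : Fin n → ℝ) (j : Fin n) (hx : 2 * D ≤ |(x j - m j) / √(a j)|) :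
    g x ≤ l * Real.exp (-(1 / D) * |(x j - m j) / √(a j)|) := by
  have := hg.isProbabilityMeasure
  rcases (hg.nonneg x).eq_or_lt with h0 | hgx
  · rw [← h0]; positivity
  have hs : ∀ j, 0 < √(a j) := fun j => Real.sqrt_pos.2 (ha j)
  have hsk : 0 < √κ₀ := Real.sqrt_pos.2 hκ0
  have hD0 : 0 < D := by rw [hD]; positivity
  set d := |(x j - m j) / √(a j)| with hd
  have hd0 : 0 < d := by linarith
  set u := D / d with hu
  have hu0 : 0 < u := by positivity
  have hu1 : u ≤ 1 / 2 := by rw [hu, div_le_iff₀ hd0]; linarith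
  set w : Fin n → ℝ := u • x + (1 - u) • m with hw
  have hb : ∀ k, 0 ≤ c / 2 * √(a k) := fun k => by positivity
  set B := {y : Fin n → ℝ | ∀ k, |y k - w k| < c / 2 * √(a k)} with hB
  have hlow : ∀ y ∈ B, g x ^ u * l ^ (1 - u) ≤ g y := by
    intro y hy
    have h1u : 0 < 1 - u := by linarith
    set p : Fin n → ℝ := (1 - u)⁻¹ • (y - u • x) with hp
    have hpl : l ≤ g p := by
      refine hbox p fun k => ?_
      have e : p k - m k = (1 - u)⁻¹ * (y k - w k) := by
        simp [hp, hw]; field_simp; ring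
      rw [e, abs_mul, abs_of_pos (inv_pos.2 h1u), inv_mul_lt_iff₀ h1u]
      have h3 := hy k
      have : 0 < c * √(a k) := mul_pos hc (hs k)
      nlinarith
    have e : u • x + (1 - u) • p = y := by
      rw [hp, smul_smul, mul_inv_cancel₀ h1u.ne', one_smul]; abel
    calc g x ^ u * l ^ (1 - u) ≤ g x ^ u * g p ^ (1 - u) := by gcongr
      _ ≤ g y := by
        have := hg.rpow_mul_rpow_le x p u (1 - u) hu0 h1u (by ring)
        rwa [e] at this
  have hmass := real_densityMeasure_ge hg (measurableSet_openBox w _) (by positivity)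
    (volume_openBox w _ hb) hlow
  have hvol : ∏ k, (2 * (c / 2 * √(a k))) = c ^ n * ∏ k, √(a k) := by
    have : ∀ k, 2 * (c / 2 * √(a k)) = c * √(a k) := fun k => by ring
    simp only [this]
    rw [Finset.prod_mul_distrib, Finset.prod_const, Finset.card_univ, Fintype.card_fin]
  rw [hvol] at hmass
  have hfar : B ⊆ {y | 2 / √κ₀ * √(a j) ≤ |y j - m j|} := by
    intro y hy
    have h1 := hy j
    have h2 : |w j - m j| = D * √(a j) := by
      have : w j - m j = u * (x j - m j) := by simp [hw]; ring
      have h3 : |x j - m j| = d * √(a j) := by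
        rw [hd, abs_div, abs_of_pos (hs j), div_mul_cancel₀ _ (hs j).ne']
      rw [this, abs_mul, abs_of_pos hu0, h3, hu]
      field_simp
    have h3 : |w j - m j| ≤ |y j - w j| + |y j - m j| := by
      rw [abs_sub_comm (y j) (w j)]
      exact abs_sub_le (w j) (y j) (m j)
    have : 0 < c * √(a j) := mul_pos hc (hs j)
    simp only [Set.mem_ofPred_eq]
    rw [h2, hD] at h3
    nlinarith
  have hcheb := (measureReal_mono (μ := densityMeasure g) hfar).trans
    (hm.chebyshev_coord j (ha j) (by positivity))
  have e1 : 1 / (2 / √κ₀) ^ 2 = κ₀ / 4 := by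
    rw [div_pow, Real.sq_sqrt hκ0.le]; field_simp; norm_num
  rw [e1] at hcheb
  have hpow : g x ^ u * l ^ (1 - u) = (g x / l) ^ u * l := by
    rw [Real.div_rpow hgx.le hl.le, Real.rpow_sub hl, Real.rpow_one]
    field_simp
  rw [hpow, mul_assoc] at hmass
  have hy0 : 0 < (g x / l) ^ u := by positivity
  -- a drop by the factor `e` over the fraction `u = D / d` of the way from the mean to `x`
  -- amounts to the decay rate `1 / D`
  have h4 : (g x / l) ^ u ≤ Real.exp (-1) := by
    have h5 : (g x / l) ^ u * κ₀ ≤ κ₀ / 4 :=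
      (mul_le_mul_of_nonneg_left hκ hy0.le).trans (hmass.trans hcheb)
    have h6 : (g x / l) ^ u ≤ 1 / 4 := by
      by_contra! h; nlinarith
    refine h6.trans ?_
    rw [Real.exp_neg, one_div]
    exact inv_anti₀ (Real.exp_pos _) (Real.exp_one_lt_d9.le.trans (by norm_num))
  have h7 : g x / l ≤ Real.exp (-(1 / u)) := by
    have := Real.rpow_le_rpow hy0.le h4 (inv_nonneg.2 hu0.le)
    rw [Real.rpow_rpow_inv (by positivity) hu0.ne', ← Real.exp_mul] at this
    rwa [neg_one_mul, ← one_div] at this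
  rw [div_le_iff₀' hl] at h7
  refine h7.trans (le_of_eq ?_)
  rw [hu]
  congr 2
  field_simp

end IsLogConcaveDensity

/-- A log-concave density with mean `m` and diagonal covariance matrix `diag a` lies below a product
of two-sided exponentials with centre `m` and scales `√a`, with constants depending only on the
dimension. -/
theorem exists_expEnvelope_bound (n : ℕ) :
    ∃ A c : ℝ, 0 < A ∧ 0 < c ∧ ∀ (g : (Fin n → ℝ) → ℝ) (m a : Fin n → ℝ),
      IsLogConcaveDensity g → HasDiagonalMoments (densityMeasure g) m a → (∀ j, 0 < a j) →
        ∀ x, g x ≤ expEnvelope A c m (fun j => √(a j)) x := by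
  -- `η₁` is the level for anti-concentration with constant `c₀`; the level `η` is so small that its
  -- superlevel set misses at most mass `(c₀ / 128) ^ 2`, as `openBox_subset` requires
  set η₁ : ℝ := (2 ^ (n + 3))⁻¹ with hη₁
  have hη₁0 : 0 < η₁ := by positivity
  set c₀ : ℝ := η₁ ^ 2 * (1 / 16) ^ n / 4 with hc₀
  have hc₀0 : 0 < c₀ := by positivity
  have hc₀1 : c₀ ≤ 1 := by
    have h1 : η₁ ≤ 1 := inv_le_one_of_one_le₀ (one_le_pow₀ (by norm_num))
    have h2 : ((1 : ℝ) / 16) ^ n ≤ 1 := pow_le_one₀ (by norm_num) (by norm_num)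
    have h3 : η₁ ^ 2 ≤ 1 := pow_le_one₀ hη₁0.le h1
    have h4 : η₁ ^ 2 * (1 / 16) ^ n ≤ 1 := mul_le_one₀ h3 (by positivity) h2
    rw [hc₀]; linarith
  set η : ℝ := (c₀ / 128) ^ 2 / 2 ^ n with hη
  have hη0 : 0 < η := by positivity
  set c₁ : ℝ := c₀ / (64 * (n + 1)) with hc₁
  have hc₁0 : 0 < c₁ := by positivity
  set κ₀ : ℝ := η ^ 2 * c₁ ^ n / (4 * (4 * (n + 1)) ^ n) with hκ₀
  have hκ₀0 : 0 < κ₀ := by positivity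
  set D : ℝ := c₁ + 2 / √κ₀ with hD
  have hD0 : 0 < D := by positivity
  refine ⟨2 * Real.exp 2 / (η ^ 2 * (2 * c₁) ^ n), 1 / (D * (n + 1)), by positivity, by positivity,
    fun g m a hg hm ha x => ?_⟩
  have := hg.isProbabilityMeasure
  obtain ⟨x₀, hx₀, hmax⟩ := hg.exists_half_max
  set M := g x₀ with hM
  have hs : ∀ j, 0 < √(a j) := fun j => Real.sqrt_pos.2 (ha j)
  set P := ∏ j, √(a j) with hP
  have hP0 : 0 < P := Finset.prod_pos fun j _ => hs j
  have hbox := hg.openBox_subset hm ha hc₀0 hc₀1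
    (fun θ hθ => hg.anticoncentration hm hη₁0 (by rw [hη₁]; field_simp; exact le_rfl) θ rfl hθ)
    (K := {x | η ^ 2 * M ≤ g x}) (measurableSet_le measurable_const hg.measurable)
    (by simpa using hg.quasiconcaveOn (η ^ 2 * M))
    ((hg.real_compl_superlevel_le hη0.le x₀).trans (le_of_eq (by rw [hη]; field_simp)))
  have hup : M * (η ^ 2 * (2 * c₁) ^ n * P) ≤ 1 := by
    have h1 := real_densityMeasure_ge hg (measurableSet_openBox m fun j => c₁ * √(a j))
      (by positivity) (volume_openBox m _ fun j => mul_nonneg hc₁0.le (hs j).le) hbox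
    have h2 : ∏ j, (2 * (c₁ * √(a j))) = (2 * c₁) ^ n * P := by
      simp only [← mul_assoc]
      rw [Finset.prod_mul_distrib, Finset.prod_const, Finset.card_univ, Fintype.card_fin]
    rw [h2] at h1
    calc M * (η ^ 2 * (2 * c₁) ^ n * P) = η ^ 2 * M * ((2 * c₁) ^ n * P) := by ring
      _ ≤ 1 := h1.trans measureReal_le_one
  have hlow := hg.half_le_max_mul hm ha (by positivity) hmax
  have hκ : κ₀ ≤ η ^ 2 * M * (c₁ ^ n * P) := by
    rw [hκ₀, div_le_iff₀ (by positivity)]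
    have h1 : 0 < η ^ 2 * c₁ ^ n := by positivity
    calc η ^ 2 * c₁ ^ n = 2 * (η ^ 2 * c₁ ^ n) * (1 / 2) := by ring
      _ ≤ 2 * (η ^ 2 * c₁ ^ n) * (2 * M * ((4 * (n + 1)) ^ n * P)) := by gcongr
      _ = _ := by ring
  have hdecay : ∀ j, g x ≤ 2 * M * Real.exp 2 * Real.exp (-(1 / D) * |(x j - m j) / √(a j)|) := by
    intro j
    rcases le_total (2 * D) |(x j - m j) / √(a j)| with h | h
    · refine (hg.le_exp_of_openBox hm ha hc₁0 (by positivity) (fun y hy => hbox hy) hκ₀0 hκ hD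
        x j h).trans ?_
      refine mul_le_mul_of_nonneg_right ?_ (Real.exp_pos _).le
      have h1 : η ^ 2 ≤ 1 := by
        have h2 : η ≤ 1 := by
          rw [hη]
          refine div_le_one_of_le₀ ?_ (by positivity)
          exact (pow_le_one₀ (by positivity) (by linarith)).trans (one_le_pow₀ (by norm_num))
        exact pow_le_one₀ hη0.le h2
      have h3 : 1 ≤ Real.exp 2 := Real.one_le_exp (by norm_num)
      nlinarith [mul_le_mul_of_nonneg_right h1 hx₀.le]
    · refine (hmax x).trans ?_
      rw [mul_assoc (2 * M), ← Real.exp_add]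
      refine le_mul_of_one_le_right (by positivity) (Real.one_le_exp ?_)
      have : 1 / D * |(x j - m j) / √(a j)| ≤ 1 / D * (2 * D) := by gcongr
      rw [show 1 / D * (2 * D) = 2 by field_simp] at this
      linarith
  have hsum : g x ≤ 2 * M * Real.exp 2 *
      Real.exp (-(1 / (D * (n + 1))) * ∑ j, |(x j - m j) / √(a j)|) := by
    rcases isEmpty_or_nonempty (Fin n) with hn | hn
    · simp only [Finset.univ_eq_empty, Finset.sum_empty, mul_zero, Real.exp_zero, mul_one]
      exact (hmax x).trans (le_mul_of_one_le_right (by positivity) (Real.one_le_exp (by norm_num)))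
    -- the decay in the worst coordinate controls the sum over all coordinates
    · obtain ⟨j, hj⟩ := Finite.exists_max fun j => |(x j - m j) / √(a j)|
      refine (hdecay j).trans ?_
      gcongr 2 * M * Real.exp 2 * Real.exp ?_
      have h1 : ∑ k, |(x k - m k) / √(a k)| ≤ n * |(x j - m j) / √(a j)| := by
        refine (Finset.sum_le_sum fun k _ => hj k).trans (le_of_eq ?_)
        simp
      rw [neg_mul, neg_mul, neg_le_neg_iff, one_div_mul_eq_div, one_div_mul_eq_div,
        div_le_div_iff₀ (by positivity) hD0]
      have h2 := abs_nonneg ((x j - m j) / √(a j))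
      nlinarith
  refine hsum.trans ?_
  have hP' : expEnvelope (2 * Real.exp 2 / (η ^ 2 * (2 * c₁) ^ n)) (1 / (D * (n + 1))) m
      (fun j => √(a j)) x = 2 * Real.exp 2 / (η ^ 2 * (2 * c₁) ^ n) * P⁻¹ *
        Real.exp (-(1 / (D * (n + 1))) * ∑ j, |(x j - m j) / √(a j)|) := by
    rw [expEnvelope, Finset.prod_mul_distrib, Finset.prod_inv_distrib, ← Real.exp_sum,
      ← Finset.mul_sum, mul_assoc]
  rw [hP']
  refine mul_le_mul_of_nonneg_right ?_ (Real.exp_pos _).le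
  rw [← div_eq_mul_inv, div_div, le_div_iff₀ (by positivity)]
  nlinarith [Real.exp_pos 2]

/-! ### Smoothing by small cubes -/

theorem HasDiagonalMoments.conv {n : ℕ} {κ κ' : Measure (Fin n → ℝ)} [IsProbabilityMeasure κ]
    [IsProbabilityMeasure κ'] {m a m' a' : Fin n → ℝ} (h : HasDiagonalMoments κ m a)
    (h' : HasDiagonalMoments κ' m' a') :
    HasDiagonalMoments (κ ∗ κ') (fun j => m j + m' j) (fun j => a j + a' j) where
  memLp j := by
    have hj : Measurable fun x : Fin n → ℝ => x j := measurable_pi_apply j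
    rw [Measure.conv, memLp_map_measure_iff hj.aestronglyMeasurable (by fun_prop)]
    exact ((h.memLp j).comp_fst κ').add ((h'.memLp j).comp_snd κ)
  mean j := by
    have hj : Measurable fun x : Fin n → ℝ => x j := measurable_pi_apply j
    rw [Measure.conv, integral_map (by fun_prop) hj.aestronglyMeasurable]
    simp only [Pi.add_apply]
    rw [integral_add (((h.memLp j).integrable (by norm_num)).comp_fst κ')
      (((h'.memLp j).integrable (by norm_num)).comp_snd κ),
      integral_fun_fst (fun x : Fin n → ℝ => x j), integral_fun_snd (fun x : Fin n → ℝ => x j),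
      h.mean, h'.mean]
    simp
  variance θ := by
    have hθ : Measurable fun x : Fin n → ℝ => ∑ j, θ j * x j := by fun_prop
    rw [Measure.conv, variance_map hθ.aemeasurable (by fun_prop)]
    have : (fun x : Fin n → ℝ => ∑ j, θ j * x j) ∘ (fun p : (Fin n → ℝ) × (Fin n → ℝ) =>
        p.1 + p.2) = fun p => ∑ j, θ j * p.1 j + ∑ j, θ j * p.2 j := by
      ext p; simp [mul_add, Finset.sum_add_distrib]
    rw [this, variance_add_prod (h.memLp_functional θ) (h'.memLp_functional θ), h.variance,
      h'.variance, ← Finset.sum_add_distrib]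
    exact Finset.sum_congr rfl fun j _ => by ring

/-- The uniform probability measure on the interval `[-δ, δ]`. -/
noncomputable def intervalUniform (δ : ℝ) : Measure ℝ :=
  (ENNReal.ofReal (2 * δ))⁻¹ • volume.restrict (Set.Icc (-δ) δ)

/-- The uniform probability measure on the cube `[-δ, δ]ⁿ`. -/
noncomputable def cubeUniform (n : ℕ) (δ : ℝ) : Measure (Fin n → ℝ) :=
  Measure.pi fun _ => intervalUniform δ

theorem isProbabilityMeasure_intervalUniform {δ : ℝ} (hδ : 0 < δ) :
    IsProbabilityMeasure (intervalUniform δ) := by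
  constructor
  rw [intervalUniform, Measure.smul_apply, Measure.restrict_apply_univ, Real.volume_Icc,
    smul_eq_mul, show δ - -δ = 2 * δ by ring]
  exact ENNReal.inv_mul_cancel (by simpa using hδ) ENNReal.ofReal_ne_top

theorem isProbabilityMeasure_cubeUniform (n : ℕ) {δ : ℝ} (hδ : 0 < δ) :
    IsProbabilityMeasure (cubeUniform n δ) := by
  have := isProbabilityMeasure_intervalUniform hδ
  rw [cubeUniform]
  infer_instance

theorem integral_intervalUniform {δ : ℝ} (hδ : 0 < δ) (f : ℝ → ℝ) :
    ∫ x, f x ∂intervalUniform δ = (2 * δ)⁻¹ * ∫ x in (-δ)..δ, f x := by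
  rw [intervalUniform, integral_smul_measure, ENNReal.toReal_inv,
    ENNReal.toReal_ofReal (by positivity), intervalIntegral.integral_of_le (by linarith),
    integral_Icc_eq_integral_Ioc, smul_eq_mul]

theorem memLp_id_intervalUniform {δ : ℝ} (hδ : 0 < δ) :
    MemLp (fun x : ℝ => x) 2 (intervalUniform δ) := by
  have := isProbabilityMeasure_intervalUniform hδ
  refine MemLp.of_bound (by fun_prop) δ ?_
  refine Measure.ae_smul_measure ?_ _
  filter_upwards [ae_restrict_mem measurableSet_Icc] with x hx
  exact abs_le.2 hx

theorem variance_id_intervalUniform {δ : ℝ} (hδ : 0 < δ) :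
    Var[fun x => x; intervalUniform δ] = δ ^ 2 / 3 := by
  have := isProbabilityMeasure_intervalUniform hδ
  rw [variance_eq_sub (memLp_id_intervalUniform hδ)]
  simp only [Pi.pow_apply]
  rw [integral_intervalUniform hδ (fun x => x ^ 2), integral_intervalUniform hδ, integral_pow,
    integral_id]
  field_simp
  norm_num
  ring

theorem hasDiagonalMoments_cubeUniform (n : ℕ) {δ : ℝ} (hδ : 0 < δ) :
    HasDiagonalMoments (cubeUniform n δ) (fun _ => 0) (fun _ => δ ^ 2 / 3) := by
  have := isProbabilityMeasure_intervalUniform hδ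
  have hmp : ∀ j, MeasurePreserving (fun x : Fin n → ℝ => x j) (cubeUniform n δ)
      (intervalUniform δ) := fun j => measurePreserving_eval (fun _ => intervalUniform δ) j
  refine ⟨fun j => ?_, fun j => ?_, fun θ => ?_⟩
  · exact (memLp_id_intervalUniform hδ).comp_measurePreserving (hmp j)
  · have h1 : ∫ x, x ∂intervalUniform δ = 0 := by
      rw [integral_intervalUniform hδ, integral_id]; ring
    rw [← h1, ← (hmp j).map_eq, integral_map (hmp j).aemeasurable (by fun_prop)]
  · have := variance_sum_pi (μ := fun _ : Fin n => intervalUniform δ) (X := fun j x => θ j * x)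
      fun j => (memLp_id_intervalUniform hδ).const_mul (θ j)
    rw [cubeUniform]
    convert this using 1
    · congr 1; ext x; simp
    · refine Finset.sum_congr rfl fun j _ => ?_
      rw [variance_const_mul, variance_id_intervalUniform hδ]

theorem cubeUniform_eq (n : ℕ) {δ : ℝ} (hδ : 0 < δ) :
    cubeUniform n δ = (ENNReal.ofReal ((2 * δ) ^ n))⁻¹ •
      volume.restrict (Metric.closedBall (0 : Fin n → ℝ) δ) := by
  have := isProbabilityMeasure_intervalUniform hδ
  refine (Measure.pi_eq fun s hs => ?_)
  have hball : Metric.closedBall (0 : Fin n → ℝ) δ = Set.univ.pi fun _ => Set.Icc (-δ) δ := by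
    rw [closedBall_pi _ hδ.le]
    simp [Real.closedBall_eq_Icc]
  rw [Measure.smul_apply, Measure.restrict_apply (MeasurableSet.univ_pi hs), hball,
    ← Set.pi_inter_distrib, volume_pi, Measure.pi_pi]
  simp only [intervalUniform, Measure.smul_apply, smul_eq_mul]
  rw [Finset.prod_mul_distrib, Finset.prod_const, Finset.card_univ, Fintype.card_fin,
    ENNReal.ofReal_pow (by positivity), ENNReal.inv_pow]
  congr 1
  exact Finset.prod_congr rfl fun j _ => (Measure.restrict_apply (hs j)).symm

/-- The average `μ(x + [-δ, δ]ⁿ) / (2δ)ⁿ` of `μ` over the cube around `x`. This is the density of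
the sum of independent random vectors distributed according to `μ` and uniformly on the cube. -/
noncomputable def cubeAverage {n : ℕ} (μ : Measure (Fin n → ℝ)) (δ : ℝ) (x : Fin n → ℝ) : ℝ :=
  μ.real (Metric.closedBall x δ) / (2 * δ) ^ n

theorem measurable_cubeAverage {n : ℕ} (μ : Measure (Fin n → ℝ)) [SFinite μ] (δ : ℝ) :
    Measurable (cubeAverage μ δ) := by
  have hs : MeasurableSet {p : (Fin n → ℝ) × (Fin n → ℝ) | dist p.2 p.1 ≤ δ} :=
    measurableSet_le (by fun_prop) measurable_const
  have := measurable_measure_prodMk_left (ν := μ) hs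
  exact (this.ennreal_toReal).div_const _

theorem conv_cubeUniform {n : ℕ} (μ : Measure (Fin n → ℝ)) [IsFiniteMeasure μ] {δ : ℝ}
    (hδ : 0 < δ) : μ ∗ cubeUniform n δ = densityMeasure (cubeAverage μ δ) := by
  have := isProbabilityMeasure_cubeUniform n hδ
  refine Measure.ext_of_lintegral _ fun F hF => ?_
  rw [Measure.lintegral_conv hF, lintegral_densityMeasure (measurable_cubeAverage μ δ) hF]
  set C := (ENNReal.ofReal ((2 * δ) ^ n))⁻¹ with hC
  have h1 : ∀ x, ∫⁻ y, F (x + y) ∂cubeUniform n δ =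
      ∫⁻ z, C * ((Metric.closedBall x δ).indicator F z) := by
    intro x
    rw [cubeUniform_eq n hδ, lintegral_smul_measure, smul_eq_mul, lintegral_const_mul _
      (hF.indicator measurableSet_closedBall), ← lintegral_indicator measurableSet_closedBall,
      ← lintegral_add_left_eq_self (μ := (volume : Measure (Fin n → ℝ)))
        ((Metric.closedBall x δ).indicator F) x]
    congr 2
    ext y
    classical simp [Set.indicator_apply]
  simp only [h1]
  rw [lintegral_lintegral_swap]
  · refine lintegral_congr fun z => ?_
    have h2 : ∀ x, C * (Metric.closedBall x δ).indicator F z =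
        C * F z * (Metric.closedBall z δ).indicator 1 x := by
      intro x
      classical
      simp only [Set.indicator_apply, Metric.mem_closedBall, dist_comm z x, Pi.one_apply]
      split_ifs <;> simp
    simp only [h2]
    rw [lintegral_const_mul _ (measurable_one.indicator measurableSet_closedBall),
      lintegral_indicator_one measurableSet_closedBall, cubeAverage,
      ENNReal.ofReal_div_of_pos (by positivity), ofReal_measureReal, div_eq_mul_inv]
    ring
  · refine Measurable.aemeasurable ?_
    have hs : MeasurableSet {p : (Fin n → ℝ) × (Fin n → ℝ) | dist p.2 p.1 ≤ δ} :=
      measurableSet_le (by fun_prop) measurable_const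
    have : Measurable fun p : (Fin n → ℝ) × (Fin n → ℝ) =>
      C * {p : (Fin n → ℝ) × (Fin n → ℝ) | dist p.2 p.1 ≤ δ}.indicator (fun p => F p.2) p :=
      ((hF.comp measurable_snd).indicator hs).const_mul _
    exact this

/-- Log-concavity of a measure tested on sup-norm balls of equal radius: the measure of the ball is
a log-concave function of its centre. -/
def IsLogConcaveOnCubes {n : ℕ} (μ : Measure (Fin n → ℝ)) : Prop :=
  ∀ (x y : Fin n → ℝ) (δ a b : ℝ), 0 < δ → 0 < a → 0 < b → a + b = 1 →
    μ.real (Metric.closedBall x δ) ^ a * μ.real (Metric.closedBall y δ) ^ b ≤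
      μ.real (Metric.closedBall (a • x + b • y) δ)

theorem IsLogConcaveOnCubes.isLogConcaveDensity {n : ℕ} {μ : Measure (Fin n → ℝ)}
    [IsProbabilityMeasure μ] (h : IsLogConcaveOnCubes μ) {δ : ℝ} (hδ : 0 < δ) :
    IsLogConcaveDensity (cubeAverage μ δ) where
  measurable := measurable_cubeAverage μ δ
  nonneg x := by unfold cubeAverage; positivity
  bounded := ⟨1 / (2 * δ) ^ n, fun x => by
    unfold cubeAverage; gcongr; exact measureReal_le_one⟩
  rpow_mul_rpow_le x y a b ha hb hab := by
    have hv : 0 < (2 * δ) ^ n := by positivity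
    simp only [cubeAverage]
    rw [Real.div_rpow (by positivity) hv.le, Real.div_rpow (by positivity) hv.le,
      div_mul_div_comm, ← Real.rpow_add hv, hab, Real.rpow_one]
    gcongr
    exact h x y δ a b hδ ha hb hab
  isProbabilityMeasure := by
    have := isProbabilityMeasure_cubeUniform n hδ
    rw [← conv_cubeUniform μ hδ]
    infer_instance

/-! ### Estimates for convolutions, and densities -/

/-- Convolution with a measure supported in a ball of radius `r` moves mass by at most `r`. -/
theorem measure_le_conv_of_add_mem {n : ℕ} {ρ w : Measure (Fin n → ℝ)}
    [SFinite w] {r : ℝ} (hw : w (Metric.closedBall 0 r) = 1)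
    {S T : Set (Fin n → ℝ)} (hT : MeasurableSet T)
    (h : ∀ x ∈ S, ∀ y ∈ Metric.closedBall (0 : Fin n → ℝ) r, x + y ∈ T) : ρ S ≤ (ρ ∗ w) T := by
  rw [Measure.conv, Measure.map_apply (by fun_prop) hT]
  calc ρ S = ρ.prod w (S ×ˢ Metric.closedBall 0 r) := by rw [Measure.prod_prod, hw, mul_one]
    _ ≤ _ := measure_mono fun p hp => h _ hp.1 _ hp.2

theorem conv_le_measure_of_add_mem {n : ℕ} {ρ w : Measure (Fin n → ℝ)}
    [IsProbabilityMeasure ρ] [IsProbabilityMeasure w] {r : ℝ} (hw : w (Metric.closedBall 0 r) = 1)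
    {S T : Set (Fin n → ℝ)} (hS : MeasurableSet S)
    (h : ∀ x, ∀ y ∈ Metric.closedBall (0 : Fin n → ℝ) r, x + y ∈ S → x ∈ T) :
    (ρ ∗ w) S ≤ ρ T := by
  rw [Measure.conv, Measure.map_apply (by fun_prop) hS]
  have hc : w (Metric.closedBall 0 r)ᶜ = 0 := by
    rw [prob_compl_eq_zero_iff measurableSet_closedBall, hw]
  calc ρ.prod w ((fun p : (Fin n → ℝ) × (Fin n → ℝ) => p.1 + p.2) ⁻¹' S)
      ≤ ρ.prod w (T ×ˢ Set.univ ∪ Set.univ ×ˢ (Metric.closedBall 0 r)ᶜ) := by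
        refine measure_mono fun p hp => ?_
        by_cases h2 : p.2 ∈ Metric.closedBall (0 : Fin n → ℝ) r
        · exact Or.inl ⟨h _ _ h2 hp, trivial⟩
        · exact Or.inr ⟨trivial, h2⟩
    _ ≤ ρ T := by
        refine (measure_union_le _ _).trans (le_of_eq ?_)
        rw [Measure.prod_prod, Measure.prod_prod, hc]
        simp

theorem conv_cubeUniform_closedBall {n : ℕ} {δ : ℝ} (hδ : 0 < δ) :
    (cubeUniform n δ ∗ cubeUniform n δ) (Metric.closedBall 0 (2 * δ)) = 1 := by
  have := isProbabilityMeasure_cubeUniform n hδ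
  have hu : cubeUniform n δ (Metric.closedBall 0 δ) = 1 := by
    rw [cubeUniform_eq n hδ, Measure.smul_apply, Measure.restrict_apply_self,
      Real.volume_pi_closedBall _ hδ.le, Fintype.card_fin, smul_eq_mul]
    exact ENNReal.inv_mul_cancel (by simp; positivity) ENNReal.ofReal_ne_top
  refine le_antisymm prob_le_one ?_
  rw [← hu]
  refine measure_le_conv_of_add_mem hu measurableSet_closedBall fun x hx y hy => ?_
  rw [mem_closedBall_zero_iff] at *
  exact (norm_add_le x y).trans (by linarith)

/-- For two independent log-concave random vectors with diagonal covariance matrices `diag a` and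
`diag b` satisfying `a + b = 1`, the law of the sum is at most a multiple of Lebesgue measure on
compact sets, and it is Lipschitz under translations in a direction `eᵢ` with `a i, b i > 0`. The
laws are first smoothed by small cubes, which makes them absolutely continuous even if they are
degenerate; the bounds do not depend on the size of the cubes. -/
theorem exists_conv_compact_estimates (n : ℕ) :
    ∃ M C : ℝ, 0 < M ∧ 0 < C ∧ ∀ (μ ν : Measure (Fin n → ℝ)) [IsProbabilityMeasure μ]
      [IsProbabilityMeasure ν] (m m' a b : Fin n → ℝ),
      IsLogConcaveOnCubes μ → IsLogConcaveOnCubes ν →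
      HasDiagonalMoments μ m a → HasDiagonalMoments ν m' b →
      (∀ j, 0 ≤ a j) → (∀ j, 0 ≤ b j) → (∀ j, a j + b j = 1) →
      (∀ K, IsCompact K → (μ ∗ ν) K ≤ ENNReal.ofReal M * volume K) ∧
      ∀ i, 0 < a i → 0 < b i → ∀ (t : ℝ) (K : Set (Fin n → ℝ)), IsCompact K →
        (μ ∗ ν) ((fun x : Fin n → ℝ => x + t • (Pi.single i 1 : Fin n → ℝ)) ⁻¹' K) ≤
          (μ ∗ ν) K + ENNReal.ofReal (C / √(a i * b i) * |t|) * volume K := by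
  obtain ⟨A, c, hA, hc, henv⟩ := exists_expEnvelope_bound n
  refine ⟨A ^ 2 * (4 / c) ^ n, 2 * A ^ 2 * (4 / c) ^ (n - 1), by positivity, by positivity,
    fun μ ν _ _ m m' a b hμ hν hmμ hmν ha hb hab => ?_⟩
  have hα : ∀ δ : ℝ, 0 < δ → ∀ j, 0 < a j + δ ^ 2 / 3 := fun δ hδ j => by
    have := ha j; positivity
  have hβ : ∀ δ : ℝ, 0 < δ → ∀ j, 0 < b j + δ ^ 2 / 3 := fun δ hδ j => by
    have := hb j; positivity
  have hαβ : ∀ δ : ℝ, 0 < δ → ∀ j, 1 / 2 ≤ √(a j + δ ^ 2 / 3) ∨ 1 / 2 ≤ √(b j + δ ^ 2 / 3) := by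
    intro δ hδ j
    have hδ2 : 0 < δ ^ 2 / 3 := by positivity
    rcases le_total (1 / 2) (a j) with h | h
    · exact Or.inl (Real.le_sqrt_of_sq_le (by linarith))
    · exact Or.inr (Real.le_sqrt_of_sq_le (by linarith [hab j]))
  have hcompl : ∀ {κ : Measure (Fin n → ℝ)} [IsProbabilityMeasure κ] {p v : Fin n → ℝ},
      IsLogConcaveOnCubes κ → HasDiagonalMoments κ p v → (∀ j, 0 ≤ v j) → ∀ δ : ℝ, 0 < δ →
      ∀ x, cubeAverage κ δ x ≤ expEnvelope A c (fun j => p j + 0)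
        (fun j => √(v j + δ ^ 2 / 3)) x := by
    intro κ _ p v hκ hmκ hv δ hδ x
    have := isProbabilityMeasure_cubeUniform n hδ
    refine henv _ _ _ (hκ.isLogConcaveDensity hδ) ?_ (fun j => by have := hv j; positivity) x
    rw [← conv_cubeUniform κ hδ]
    exact hmκ.conv (hasDiagonalMoments_cubeUniform n hδ)
  have hassoc : ∀ δ : ℝ, 0 < δ → densityMeasure (cubeAverage μ δ) ∗ densityMeasure (cubeAverage ν δ)
      = (μ ∗ ν) ∗ (cubeUniform n δ ∗ cubeUniform n δ) := by
    intro δ hδ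
    have := isProbabilityMeasure_cubeUniform n hδ
    rw [← conv_cubeUniform μ hδ, ← conv_cubeUniform ν hδ, Measure.conv_assoc,
      ← Measure.conv_assoc (cubeUniform n δ) ν, Measure.conv_comm (cubeUniform n δ) ν,
      Measure.conv_assoc ν, ← Measure.conv_assoc μ ν]
  have hlim : ∀ (κ : Measure (Fin n → ℝ)) [IsFiniteMeasureOnCompacts κ] (K : Set (Fin n → ℝ)),
      IsCompact K → ∀ s : ℝ, Filter.Tendsto (fun δ : ℝ => κ (Metric.cthickening (s * δ) K))
        (nhdsWithin 0 (Set.Ioi 0)) (nhds (κ K)) := by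
    intro κ _ K hK s
    refine (tendsto_measure_cthickening_of_isCompact hK).comp ?_
    refine Filter.Tendsto.mono_left ?_ nhdsWithin_le_nhds
    have : Continuous fun δ : ℝ => s * δ := by fun_prop
    simpa using this.tendsto 0
  have hthick : ∀ (K : Set (Fin n → ℝ)) (δ : ℝ), 0 < δ → ∀ x ∈ K,
      ∀ y ∈ Metric.closedBall (0 : Fin n → ℝ) (2 * δ), x + y ∈ Metric.cthickening (2 * δ) K := by
    intro K δ hδ x hx y hy
    refine Metric.mem_cthickening_of_dist_le _ x _ _ hx ?_
    simpa using hy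
  refine ⟨fun K hK => ?_, fun i hai hbi t K hK => ?_⟩
  · refine ge_of_tendsto (ENNReal.Tendsto.const_mul (hlim volume K hK 2)
      (Or.inr ENNReal.ofReal_ne_top)) ?_
    filter_upwards [self_mem_nhdsWithin] with δ (hδ : 0 < δ)
    have := isProbabilityMeasure_cubeUniform n hδ
    have hT : MeasurableSet (Metric.cthickening (2 * δ) K) :=
      Metric.isClosed_cthickening.measurableSet
    refine (measure_le_conv_of_add_mem (conv_cubeUniform_closedBall hδ) hT (hthick K δ hδ)).trans ?_
    rw [← hassoc δ hδ]
    exact conv_withDensity_apply_le hc (fun j => Real.sqrt_pos.2 (hα δ hδ j))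
      (fun j => Real.sqrt_pos.2 (hβ δ hδ j)) (hαβ δ hδ) (measurable_cubeAverage μ δ)
      (measurable_cubeAverage ν δ) (hμ.isLogConcaveDensity hδ).nonneg
      (hν.isLogConcaveDensity hδ).nonneg (hcompl hμ hmμ ha δ hδ) (hcompl hν hmν hb δ hδ) hT
  · refine ge_of_tendsto ((hlim (μ ∗ ν) K hK 4).add (ENNReal.Tendsto.const_mul
      (hlim volume K hK 2) (Or.inr ENNReal.ofReal_ne_top))) ?_
    filter_upwards [self_mem_nhdsWithin] with δ (hδ : 0 < δ)
    have := isProbabilityMeasure_cubeUniform n hδ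
    have hT : MeasurableSet (Metric.cthickening (2 * δ) K) :=
      Metric.isClosed_cthickening.measurableSet
    set τ : (Fin n → ℝ) → (Fin n → ℝ) := fun x => x + t • (Pi.single i 1 : Fin n → ℝ) with hτ
    have hτm : Measurable τ := by fun_prop
    have h1 : (μ ∗ ν) (τ ⁻¹' K) ≤
        ((μ ∗ ν) ∗ (cubeUniform n δ ∗ cubeUniform n δ)) (τ ⁻¹' Metric.cthickening (2 * δ) K) := by
      refine measure_le_conv_of_add_mem (conv_cubeUniform_closedBall hδ) (hT.preimage hτm)
        fun x hx y hy => ?_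
      have := hthick K δ hδ _ hx y hy
      rwa [show τ x + y = τ (x + y) by simp only [hτ]; abel] at this
    have h2 := conv_withDensity_translate_le hA.le hc (fun j => Real.sqrt_pos.2 (hα δ hδ j))
      (fun j => Real.sqrt_pos.2 (hβ δ hδ j)) (hαβ δ hδ) (measurable_cubeAverage μ δ)
      (measurable_cubeAverage ν δ) (hν.isLogConcaveDensity hδ).nonneg
      (hcompl hμ hmμ ha δ hδ) (hcompl hν hmν hb δ hδ)
      (hν.isLogConcaveDensity hδ).quasiconcaveOn i t hT
    have h3 : ((μ ∗ ν) ∗ (cubeUniform n δ ∗ cubeUniform n δ)) (Metric.cthickening (2 * δ) K) ≤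
        (μ ∗ ν) (Metric.cthickening (4 * δ) K) := by
      refine conv_le_measure_of_add_mem (conv_cubeUniform_closedBall hδ) hT fun x y hy hxy => ?_
      have hsub := Metric.cthickening_cthickening_subset (δ := 2 * δ) (ε := 2 * δ)
        (by positivity) (by positivity) K
      rw [show 2 * δ + 2 * δ = 4 * δ by ring] at hsub
      refine hsub (Metric.mem_cthickening_of_dist_le _ (x + y) _ _ hxy ?_)
      simpa using hy
    have h4 : 2 * A ^ 2 * (4 / c) ^ (n - 1) / (√(a i + δ ^ 2 / 3) * √(b i + δ ^ 2 / 3)) * |t| ≤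
        2 * A ^ 2 * (4 / c) ^ (n - 1) / √(a i * b i) * |t| := by
      have hδ2 : 0 < δ ^ 2 / 3 := by positivity
      rw [Real.sqrt_mul hai.le]
      have := Real.sqrt_pos.2 hai
      have := Real.sqrt_pos.2 hbi
      gcongr <;> linarith
    rw [← hassoc δ hδ] at h1 h3
    exact h1.trans (h2.trans (add_le_add h3 (by gcongr)))

/-- A probability measure that is Lipschitz under translations along `v` on compact sets, and at
most a multiple of Lebesgue measure there, has a density that is Lipschitz along `v` at every point:
the upper limit of its averages over shrinking cubes. -/
theorem exists_lipschitz_density {n : ℕ} (ρ : Measure (Fin n → ℝ)) [IsProbabilityMeasure ρ]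
    (v : Fin n → ℝ) {M L : ℝ} (hM : 0 ≤ M) (hL : 0 ≤ L)
    (h1 : ∀ K, IsCompact K → ρ K ≤ ENNReal.ofReal M * volume K)
    (h2 : ∀ (t : ℝ) (K : Set (Fin n → ℝ)), IsCompact K →
      ρ ((fun x : Fin n → ℝ => x + t • v) ⁻¹' K) ≤ ρ K + ENNReal.ofReal (L * |t|) * volume K) :
    ∃ f : (Fin n → ℝ) → ℝ, Measurable f ∧ (∀ x, 0 ≤ f x) ∧ ρ = densityMeasure f ∧
      ∀ x t, |f (x + t • v) - f x| ≤ L * |t| := by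
  let r : ℕ → ℝ := fun k => 1 / ((k : ℝ) + 1)
  have hr : ∀ k, 0 < r k := fun k => by positivity
  let F : ℕ → (Fin n → ℝ) → ℝ := fun k => cubeAverage ρ (r k)
  have hF0 : ∀ k x, 0 ≤ F k x := fun k x => by
    have := hr k; simp only [F, cubeAverage]; positivity
  have hvol : ∀ k (x : Fin n → ℝ), volume (Metric.closedBall x (r k)) =
      ENNReal.ofReal ((2 * r k) ^ n) := fun k x => by
    rw [Real.volume_pi_closedBall _ (hr k).le, Fintype.card_fin]
  have hFM : ∀ k x, F k x ≤ M := by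
    intro k x
    have hp : 0 < (2 * r k) ^ n := by have := hr k; positivity
    have := h1 _ (isCompact_closedBall x (r k))
    rw [hvol, ← ENNReal.ofReal_mul hM] at this
    simp only [F, cubeAverage]
    rw [div_le_iff₀ hp]
    exact ENNReal.toReal_le_of_le_ofReal (by positivity) this
  have hFL : ∀ k x t, F k x ≤ F k (x + t • v) + L * |t| := by
    intro k x t
    have hp : 0 < (2 * r k) ^ n := by have := hr k; positivity
    have := h2 t _ (isCompact_closedBall (x + t • v) (r k))
    have hpre : (fun y : Fin n → ℝ => y + t • v) ⁻¹' Metric.closedBall (x + t • v) (r k) =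
        Metric.closedBall x (r k) := by
      ext y; simp
    rw [hpre, hvol, ← ENNReal.ofReal_mul (by positivity)] at this
    have h3 := ENNReal.toReal_mono (by simp) this
    rw [ENNReal.toReal_add (measure_ne_top _ _) ENNReal.ofReal_ne_top,
      ENNReal.toReal_ofReal (by positivity)] at h3
    simp only [F, cubeAverage, Measure.real]
    rw [div_add' _ _ _ hp.ne']
    gcongr
  have hbdd : ∀ x, Filter.IsBoundedUnder (· ≤ ·) Filter.atTop fun k => F k x := fun x =>
    Filter.isBoundedUnder_of ⟨M, fun k => hFM k x⟩
  have hcob : ∀ x, Filter.IsCoboundedUnder (· ≤ ·) Filter.atTop fun k => F k x := fun x =>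
    (Filter.isBoundedUnder_of ⟨0, fun k => hF0 k x⟩ :
      Filter.IsBoundedUnder (· ≥ ·) Filter.atTop fun k => F k x).isCoboundedUnder_le
  let f : (Fin n → ℝ) → ℝ := fun x => Filter.limsup (fun k => F k x) Filter.atTop
  have hfL : ∀ x t, f x ≤ f (x + t • v) + L * |t| := by
    intro x t
    simp only [f]
    rw [← limsup_add_const _ _ _ (hbdd _) (hcob _)]
    refine Filter.limsup_le_limsup (Filter.Eventually.of_forall fun k => hFL k x t) (hcob x) ?_
    exact Filter.isBoundedUnder_of ⟨M + L * |t|, fun k => by linarith [hFM k (x + t • v)]⟩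
  have hfm : Measurable f := Measurable.limsup fun k => measurable_cubeAverage ρ (r k)
  refine ⟨f, hfm, fun x => ?_, ?_, fun x t => ?_⟩
  · exact Filter.le_limsup_of_frequently_le (Filter.Frequently.of_forall fun k => hF0 k x) (hbdd x)
  · have hac : ρ ≪ volume := by
      refine Measure.AbsolutelyContinuous.mk fun s hs hs0 => ?_
      rw [hs.measure_eq_iSup_isCompact ρ]
      simp only [ENNReal.iSup_eq_zero]
      intro K hKs hK
      refine le_antisymm ((h1 K hK).trans ?_) bot_le
      rw [measure_mono_null hKs hs0, mul_zero]
    rw [← Measure.withDensity_rnDeriv_eq ρ volume hac, densityMeasure]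
    refine withDensity_congr_ae ?_
    filter_upwards [Besicovitch.ae_tendsto_rnDeriv ρ volume, Measure.rnDeriv_ne_top ρ volume]
      with x hx hxtop
    have hr0 : Filter.Tendsto r Filter.atTop (nhdsWithin 0 (Set.Ioi 0)) :=
      tendsto_nhdsWithin_iff.2 ⟨tendsto_one_div_add_atTop_nhds_zero_nat,
        Filter.Eventually.of_forall hr⟩
    have h3 := (ENNReal.tendsto_toReal hxtop).comp (hx.comp hr0)
    have h4 : Filter.Tendsto (fun k => F k x) Filter.atTop
        (nhds (ρ.rnDeriv volume x).toReal) := by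
      refine h3.congr fun k => ?_
      have : 0 < (2 * r k) ^ n := by have := hr k; positivity
      simp only [Function.comp, hvol, F, cubeAverage, ENNReal.toReal_div, Measure.real,
        ENNReal.toReal_ofReal this.le]
    simp only [f]
    rw [h4.limsup_eq, ENNReal.ofReal_toReal hxtop]
  · rw [abs_sub_le_iff]
    have h3 := hfL (x + t • v) (-t)
    rw [neg_smul, add_neg_cancel_right, abs_neg] at h3
    constructor <;> linarith [hfL x t]

/-! ### Random vectors in Euclidean space -/

/-- If the sum of two independent random variables is square integrable, then so is each of them:
by Fubini, `X + y` is square integrable for some constant `y`. -/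
theorem memLp_coord_of_conv {n : ℕ} {μ ν : Measure (Fin n → ℝ)} [IsProbabilityMeasure μ]
    [IsProbabilityMeasure ν] {j : Fin n} (h : MemLp (fun x => x j) 2 (μ ∗ ν)) :
    MemLp (fun x => x j) 2 μ := by
  have hj : Measurable fun x : Fin n → ℝ => x j := measurable_pi_apply j
  rw [Measure.conv, memLp_map_measure_iff hj.aestronglyMeasurable (by fun_prop)] at h
  have h1 : Integrable (fun p : (Fin n → ℝ) × (Fin n → ℝ) => (p.1 j + p.2 j) ^ 2) (μ.prod ν) :=
    h.integrable_sq
  obtain ⟨y, hy⟩ := h1.prod_left_ae.exists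
  have h2 : MemLp (fun x : Fin n → ℝ => x j + y j) 2 μ :=
    (memLp_two_iff_integrable_sq (hj.add_const _).aestronglyMeasurable).2 hy
  simpa only [Pi.sub_def, add_sub_cancel_right] using h2.sub (memLp_const (y j))

theorem IsLogConcaveMeasure.isLogConcaveOnCubes {n : ℕ} {μ : Measure (EuclideanSpace ℝ (Fin n))}
    [IsProbabilityMeasure μ] (h : IsLogConcaveMeasure μ) :
    IsLogConcaveOnCubes (μ.map (WithLp.ofLp : EuclideanSpace ℝ (Fin n) → Fin n → ℝ)) := by
  intro x y δ a b hδ ha hb hab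
  have hm : Measurable (WithLp.ofLp : EuclideanSpace ℝ (Fin n) → Fin n → ℝ) := by fun_prop
  have hball : ∀ z : Fin n → ℝ, MeasurableSet
      ((WithLp.ofLp : EuclideanSpace ℝ (Fin n) → Fin n → ℝ) ⁻¹' Metric.closedBall z δ) :=
    fun z => hm measurableSet_closedBall
  obtain rfl : b = 1 - a := by linarith
  have h1 := h _ _ (hball x) (hball y) a ha (by linarith)
  have h2 : a • ((WithLp.ofLp : EuclideanSpace ℝ (Fin n) → Fin n → ℝ) ⁻¹' Metric.closedBall x δ) +
      (1 - a) • ((WithLp.ofLp : EuclideanSpace ℝ (Fin n) → Fin n → ℝ) ⁻¹' Metric.closedBall y δ) ⊆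
      WithLp.ofLp ⁻¹' Metric.closedBall (a • x + (1 - a) • y) δ := by
    rintro _ ⟨_, ⟨p, hp, rfl⟩, _, ⟨q, hq, rfl⟩, rfl⟩
    simp only [Set.mem_preimage, Metric.mem_closedBall, dist_eq_norm] at *
    have e : WithLp.ofLp (a • p + (1 - a) • q) - (a • x + (1 - a) • y) =
        a • (WithLp.ofLp p - x) + (1 - a) • (WithLp.ofLp q - y) := by
      ext j; simp; ring
    rw [e]
    refine (norm_add_le _ _).trans ?_
    rw [norm_smul, norm_smul, Real.norm_of_nonneg ha.le, Real.norm_of_nonneg hb.le]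
    nlinarith
  have h3 := ENNReal.toReal_mono (measure_ne_top _ _) (h1.trans (measure_mono h2))
  rw [ENNReal.toReal_mul, ← ENNReal.toReal_rpow, ← ENNReal.toReal_rpow] at h3
  simp only [map_measureReal_apply hm measurableSet_closedBall]
  exact h3

/-- The integrability hypothesis `hL` cannot be dropped: the entries of `covarianceMatrix` are junk
values for coordinates that are not square integrable. -/
theorem hasDiagonalMoments_of_isDiag {Ω : Type*} [MeasurableSpace Ω] {n : ℕ} {P : Measure Ω}
    [IsProbabilityMeasure P] {X : Ω → EuclideanSpace ℝ (Fin n)} (hX : AEMeasurable X P)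
    (hdiag : (covarianceMatrix X P).IsDiag)
    (hL : ∀ j, MemLp (fun x : Fin n → ℝ => x j) 2 (P.map fun ω => WithLp.ofLp (X ω))) :
    HasDiagonalMoments (P.map fun ω => WithLp.ofLp (X ω)) (fun j => ∫ ω, X ω j ∂P)
      (fun j => Var[fun ω => X ω j; P]) := by
  have hX' : AEMeasurable (fun ω => WithLp.ofLp (X ω)) P :=
    (show Measurable (WithLp.ofLp : EuclideanSpace ℝ (Fin n) → Fin n → ℝ) by
      fun_prop).comp_aemeasurable hX
  have := Measure.isProbabilityMeasure_map hX'
  have hj : ∀ j, Measurable fun x : Fin n → ℝ => x j := fun j => measurable_pi_apply j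
  refine ⟨hL, fun j => integral_map hX' (hj j).aestronglyMeasurable, fun θ => ?_⟩
  rw [variance_fun_sum fun j => (hL j).const_mul (θ j)]
  refine Finset.sum_congr rfl fun j _ => ?_
  have hcov : ∀ k, cov[fun x => θ j * x j, fun x => θ k * x k; P.map fun ω => WithLp.ofLp (X ω)] =
      θ j * (θ k * cov[fun ω => X ω j, fun ω => X ω k; P]) := by
    intro k
    rw [covariance_const_mul_left, covariance_const_mul_right,
      covariance_map_fun (hj j).aestronglyMeasurable (hj k).aestronglyMeasurable hX']
  simp only [hcov]
  rw [Finset.sum_eq_single j]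
  · rw [covariance_self]
    · ring
    · exact (hj j).comp_aemeasurable hX'
  · intro k _ hkj
    have : cov[fun ω => X ω j, fun ω => X ω k; P] = 0 := hdiag hkj.symm
    rw [this]; ring
  · simp

theorem mainTheorem4 (n : ℕ) :
    ∃ C : ℝ, 0 < C ∧
      ∀ (Ω : Type*) [MeasurableSpace Ω] (P : Measure Ω) [IsProbabilityMeasure P]
        (X Y : Ω → EuclideanSpace ℝ (Fin n)),
        AEMeasurable X P → AEMeasurable Y P → IndepFun X Y P →
        IsLogConcaveMeasure (P.map X) → IsLogConcaveMeasure (P.map Y) →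
        (covarianceMatrix X P).IsDiag → (covarianceMatrix Y P).IsDiag →
        IsIsotropicMeasure (P.map (fun ω => X ω + Y ω)) →
        ∀ i : Fin n,
          0 < variance (fun ω => inner ℝ (X ω) (EuclideanSpace.single i (1 : ℝ))) P →
          0 < variance (fun ω => inner ℝ (Y ω) (EuclideanSpace.single i (1 : ℝ))) P →
          ∃ f : EuclideanSpace ℝ (Fin n) → ℝ,
            IsDensityOf f (fun ω => X ω + Y ω) P ∧
            LipschitzInDirection f (EuclideanSpace.single i (1 : ℝ))
              (C / Real.sqrt
                (variance (fun ω => inner ℝ (X ω) (EuclideanSpace.single i (1 : ℝ))) P *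
                  variance (fun ω => inner ℝ (Y ω) (EuclideanSpace.single i (1 : ℝ))) P)) := by
  obtain ⟨M, C, hM, hC, hest⟩ := exists_conv_compact_estimates n
  refine ⟨C, hC, ?_⟩
  intro Ω _ P _ X Y hX hY hXY hlX hlY hdX hdY hiso i hvX hvY
  have hinner : ∀ (x : EuclideanSpace ℝ (Fin n)) j,
      inner ℝ x (EuclideanSpace.single j (1 : ℝ)) = x j := fun x j => by
    simp [EuclideanSpace.inner_single_right]
  simp only [hinner] at hvX hvY ⊢
  have hofLp : Measurable (WithLp.ofLp : EuclideanSpace ℝ (Fin n) → Fin n → ℝ) := by fun_prop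
  have hX' : AEMeasurable (fun ω => WithLp.ofLp (X ω)) P := hofLp.comp_aemeasurable hX
  have hY' : AEMeasurable (fun ω => WithLp.ofLp (Y ω)) P := hofLp.comp_aemeasurable hY
  have hZ : AEMeasurable (fun ω => X ω + Y ω) P := hX.add hY
  set μ := P.map fun ω => WithLp.ofLp (X ω) with hμ
  set ν := P.map fun ω => WithLp.ofLp (Y ω) with hν
  have : IsProbabilityMeasure μ := Measure.isProbabilityMeasure_map hX'
  have : IsProbabilityMeasure ν := Measure.isProbabilityMeasure_map hY'
  have : IsProbabilityMeasure (P.map X) := Measure.isProbabilityMeasure_map hX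
  have : IsProbabilityMeasure (P.map Y) := Measure.isProbabilityMeasure_map hY
  have : IsProbabilityMeasure (P.map fun ω => X ω + Y ω) := Measure.isProbabilityMeasure_map hZ
  have hconv : μ ∗ ν = (P.map fun ω => X ω + Y ω).map WithLp.ofLp := by
    rw [AEMeasurable.map_map_of_aemeasurable hofLp.aemeasurable hZ, hμ, hν]
    exact ((hXY.comp hofLp hofLp).map_add_eq_map_conv_map₀ hX' hY').symm
  -- Square integrability is implicit in isotropy: a Bochner integral equal to `1` is not a junk value.
  have hsq : ∀ j, ∫ z, (z j) ^ 2 ∂(P.map fun ω => X ω + Y ω) = 1 := by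
    intro j
    have := hiso.2 (EuclideanSpace.single j 1) (by simp)
    simpa only [hinner] using this
  have hcoord : ∀ j, Measurable fun z : EuclideanSpace ℝ (Fin n) => z j := fun j => by fun_prop
  have hLZ : ∀ j, MemLp (fun z : EuclideanSpace ℝ (Fin n) => z j) 2
      (P.map fun ω => X ω + Y ω) := fun j =>
    (memLp_two_iff_integrable_sq (hcoord j).aestronglyMeasurable).2
      (Integrable.of_integral_ne_zero (by rw [hsq j]; exact one_ne_zero))
  have hLconv : ∀ j, MemLp (fun x : Fin n → ℝ => x j) 2 (μ ∗ ν) := fun j => by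
    rw [hconv, memLp_map_measure_iff (measurable_pi_apply j).aestronglyMeasurable
      hofLp.aemeasurable]
    exact hLZ j
  have hLX : ∀ j, MemLp (fun x : Fin n → ℝ => x j) 2 μ := fun j => memLp_coord_of_conv (hLconv j)
  have hLY : ∀ j, MemLp (fun x : Fin n → ℝ => x j) 2 ν := fun j =>
    memLp_coord_of_conv (ν := μ) (by rw [Measure.conv_comm]; exact hLconv j)
  have hmX := hasDiagonalMoments_of_isDiag hX hdX hLX
  have hmY := hasDiagonalMoments_of_isDiag hY hdY hLY
  have hsum : ∀ j, Var[fun ω => X ω j; P] + Var[fun ω => Y ω j; P] = 1 := by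
    intro j
    have h1 := (hmX.conv hmY).variance (Pi.single j 1)
    simp only [Pi.single_apply, ite_pow, ite_mul, one_pow, one_mul, zero_mul, ne_eq,
      OfNat.ofNat_ne_zero, not_false_eq_true, zero_pow, Finset.sum_ite_eq', Finset.mem_univ,
      if_true] at h1
    rw [← h1, hconv, variance_map (measurable_pi_apply j).aemeasurable hofLp.aemeasurable]
    have h2 := variance_eq_sub (hLZ j)
    have h3 : ∫ z, z j ∂(P.map fun ω => X ω + Y ω) = 0 := by
      have hi : Integrable (fun z => z) (P.map fun ω => X ω + Y ω) :=
        Integrable.of_eval_piLp fun k => (hLZ k).integrable (by norm_num)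
      have := (EuclideanSpace.proj (𝕜 := ℝ) j).integral_comp_comm hi
      rw [hiso.1, map_zero] at this
      simpa using this
    simp only [Pi.pow_apply] at h2
    rw [hsq j, h3] at h2
    simpa [Function.comp_def] using h2
  have hlcX : IsLogConcaveOnCubes μ := by
    have := hlX.isLogConcaveOnCubes
    rwa [AEMeasurable.map_map_of_aemeasurable hofLp.aemeasurable hX] at this
  have hlcY : IsLogConcaveOnCubes ν := by
    have := hlY.isLogConcaveOnCubes
    rwa [AEMeasurable.map_map_of_aemeasurable hofLp.aemeasurable hY] at this
  obtain ⟨hK1, hK2⟩ := hest μ ν _ _ _ _ hlcX hlcY hmX hmY (fun j => variance_nonneg _ _)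
    (fun j => variance_nonneg _ _) hsum
  obtain ⟨f, hfm, hf0, hfρ, hfL⟩ := exists_lipschitz_density (μ ∗ ν) (Pi.single i 1) hM.le
    (by positivity) hK1 (hK2 i hvX hvY)
  refine ⟨fun z => f (WithLp.ofLp z), ⟨hfm.comp hofLp, fun z => hf0 _, ?_⟩, fun z t => ?_⟩
  · refine Measure.ext_of_lintegral _ fun F hF => ?_
    have hvp := PiLp.volume_preserving_ofLp (Fin n)
    have hG : Measurable fun x : Fin n → ℝ => F (WithLp.toLp 2 x) := hF.comp (by fun_prop)
    rw [lintegral_withDensity_eq_lintegral_mul _ (by fun_prop) hF]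
    have h1 : ∫⁻ z, F z ∂(P.map fun ω => X ω + Y ω) =
        ∫⁻ x : Fin n → ℝ, F (WithLp.toLp 2 x) ∂(μ ∗ ν) := by
      rw [hconv, lintegral_map hG hofLp]
    rw [h1, hfρ, lintegral_densityMeasure hfm hG]
    exact (hvp.lintegral_comp (hfm.ennreal_ofReal.mul hG)).symm
  · exact hfL (WithLp.ofLp z) t
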